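/- A \emph{permutation} is a structure $P=(X,<_0,<_1)$ consisting of a set $X$ and two strict linear orders on $X$. An \emph{embedding} is an injective map that preserves and reflects both relations; a substructure (\emph{subpermutation}) is a subset with the restricted orders. The \emph{age} of $P$ is the class of all finite permutations that embed into $P$. $P$ is \emph{homogeneous} if every isomorphism between finite subpermutations of $P$ extends to an automorphism of $P$. A class $\mathcal K$ of finite structures is a \emph{Ramsey class} if for all $A,B\in\mathcal K$ and $r\in\mathbb N$ there is $C\in\mathcal K$ with $C\to(B)^A_r$, i.e. for every colouring with $r$ colours of the embeddings of $A$ into $C$ there is a substructure $B'\cong B$ of $C$ such that all embeddings of $A$ into $B'$ have the same colour. The empty structure is allowed and belongs to every age. By a \emph{Ramsey class of permutations} we mean a class of finite permutations that is a Ramsey class, is closed under isomorphism, is hereditary (every subpermutation of a member is a member), has the joint embedding property (any two members embed into a common member), and has at least one nonempty member. A finite permutation \emph{has a subpermutation with pattern} $p_1,\dots,p_n$ (distinct numbers) if it contains points $x_1<_1\dots<_1x_n$ such that $x_i<_0x_j$ iff $p_i<p_j$. \textbf{Theorem.} (1) The age of every countable homogeneous permutation is a Ramsey class. (2) A class of finite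 permutations that is closed under isomorphism, hereditary, has the joint embedding property and has a nonempty member is a Ramsey class if and only if it is the age of a countable homogeneous permutation. (3) The Ramsey classes of permutations are exactly the following six classes: the permutations on at most one point; the finite identity permutations (${<_1}={<_0}$); the finite reversals (${<_1}={>_0}$); the finite increasing sequences of decreasing sequences (finite permutations with no subpermutation with pattern $2,3,1$ or $3,1,2$); the finite decreasing sequences of increasing sequences (finite permutations with no subpermutation with pattern $2,1,3$ or $1,3,2$); all finite permutations. (4) Exactly five Ramsey classes of permutations have countably infinitely many members up to isomorphism. -/

import Mathlib

open FirstOrder CategoryTheory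

universe u v w

/-! ### Ramsey classes of relational structures -/

/-- The partition arrow `C → (B)^A_r`: for every colouring with `r` colours of the embeddings of
`A` into `C` there are a colour `i` and a substructure `B'` of `C` isomorphic to `B` such that
every embedding of `A` into `B'` has colour `i`. -/
def PartitionArrow (L : FirstOrder.Language.{u, v}) (C B A : Type w) [L.Structure C] [L.Structure B]
    [L.Structure A] (r : ℕ) : Prop :=
  ∀ χ : (A ↪[L] C) → Fin r, ∃ (i : Fin r) (B' : L.Substructure C),
    Nonempty (B' ≃[L] B) ∧ ∀ f : A ↪[L] B', χ (B'.subtype.comp f) = i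

/-- `K` is a Ramsey class: for all `A, B ∈ K` and every `r` there is `C ∈ K` with
`C → (B)^A_r`. -/
def IsRamseyClass {L : FirstOrder.Language.{u, v}} (K : Set (Bundled.{w} L.Structure)) : Prop :=
  ∀ A ∈ K, ∀ B ∈ K, ∀ r : ℕ, ∃ C ∈ K, PartitionArrow L C B A r

/-! ### Permutations as structures with two linear orders -/

/-- The relation symbols `<₀` and `<₁`, both binary. -/
inductive PermRel : ℕ → Type
  | lt (i : Fin 2) : PermRel 2

/-- The relational signature with two binary relation symbols. -/
def permLang : FirstOrder.Language := ⟨fun _ => Empty, PermRel⟩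

instance : permLang.IsRelational := fun _ => inferInstanceAs (IsEmpty Empty)

/-- The interpretation of the symbol `<ᵢ` in a structure `M`. -/
def permLt {M : Type w} [permLang.Structure M] (i : Fin 2) (x y : M) : Prop :=
  FirstOrder.Language.Structure.RelMap (L := permLang) (PermRel.lt i) ![x, y]

/-- `M` is a permutation: both relations are (strict) linear orders. -/
def IsPermutation (M : Type w) [permLang.Structure M] : Prop :=
  ∀ i : Fin 2, IsStrictTotalOrder M (permLt i)

/-- `M` has a subpermutation with pattern `p`: some points of `M`, listed increasingly with respect
to `<₁`, are ordered by `<₀` as the numbers `p 0, p 1, …` are. -/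
def HasPattern (M : Type w) [permLang.Structure M] {n : ℕ} (p : Fin n → ℕ) : Prop :=
  ∃ x : Fin n → M, ∀ i j : Fin n,
    (permLt 0 (x i) (x j) ↔ p i < p j) ∧ (permLt 1 (x i) (x j) ↔ i < j)

/-! ### Classes of finite permutations -/

/-- All finite permutations. -/
def allPerms : Set (Bundled.{w} permLang.Structure) :=
  {A | Finite A ∧ IsPermutation A}

/-- Permutations on at most one point. -/
def trivialPerms : Set (Bundled.{w} permLang.Structure) :=
  {A | A ∈ allPerms ∧ Subsingleton A}

/-- Finite identity permutations: the two orders agree. -/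
def identityPerms : Set (Bundled.{w} permLang.Structure) :=
  {A | A ∈ allPerms ∧ ∀ x y : A, permLt 1 x y ↔ permLt 0 x y}

/-- Finite reversals: the second order is the reverse of the first. -/
def reversalPerms : Set (Bundled.{w} permLang.Structure) :=
  {A | A ∈ allPerms ∧ ∀ x y : A, permLt 1 x y ↔ permLt 0 y x}

/-- Finite increasing sequences of decreasing sequences. -/
def incDecPerms : Set (Bundled.{w} permLang.Structure) :=
  {A | A ∈ allPerms ∧ ¬ HasPattern A ![2, 3, 1] ∧ ¬ HasPattern A ![3, 1, 2]}

/-- Finite decreasing sequences of increasing sequences. -/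
def decIncPerms : Set (Bundled.{w} permLang.Structure) :=
  {A | A ∈ allPerms ∧ ¬ HasPattern A ![2, 1, 3] ∧ ¬ HasPattern A ![1, 3, 2]}

/-- The classes of finite permutations under consideration: hereditary, closed under isomorphism,
with the joint embedding property, and with at least one nonempty member. -/
structure IsPermutationClass (K : Set (Bundled.{w} permLang.Structure)) : Prop where
  subset_allPerms : K ⊆ allPerms
  exists_nonempty : ∃ A ∈ K, Nonempty A
  isoClosed : ∀ A B : Bundled.{w} permLang.Structure, Nonempty (A ≃[permLang] B) → A ∈ K → B ∈ K
  hereditary : FirstOrder.Language.Hereditary K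
  jointEmbedding : FirstOrder.Language.JointEmbedding K

/-- `K` has countably infinitely many members up to isomorphism. -/
def IsCountablyInfiniteClass (K : Set (Bundled.{w} permLang.Structure)) : Prop :=
  ((Quotient.mk (FirstOrder.Language.equivSetoid (L := permLang))) '' K).Infinite ∧
    ((Quotient.mk (FirstOrder.Language.equivSetoid (L := permLang))) '' K).Countable

/-! All four parts go through one list: amalgamation classes of permutations are classified, and
each class on the list is shown to be Ramsey and to be the age of a countable homogeneous
permutation. Ages of homogeneous structures amalgamate. So do Ramsey classes with joint embedding:
colour copies of `A` by whether they extend to a copy of `B`; in a monochromatic copy of a common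
extension of `B` and `C` the copy of `A` inside `B` extends, hence so does the one inside `C`.

The classification (`IsAmalgamationClass.classification`) rests on forced amalgams. If two points of
`P` are separated by further points in both orders, amalgamating `P` minus one with `P` minus the
other must reproduce `P`. Hence a minimal permutation missing from the class has no such pair of
points, which leaves only 12, 21, 132, 213, 231, 312, 2413 and 3142
(`IsAmalgamationClass.exists_minimalPattern`). When 12 and 21 are present, amalgamating them over a
common point gives disjunctions between three-point patterns, and any three of the four non-monotone
three-point patterns force a five-point pattern containing the fourth. Only the six listed classes
survive.

The Ramsey property (`hasRamseyProperty_of_coding`) reduces to the finite Ramsey theorem. A member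
is coded by two rank functions, whose values are listed one after the other as a single increasing
sequence; a colouring of copies becomes a colouring of such sequences. The ranks are those of the
two orders for all permutations, and block number with `<₀`-rank for increasing sequences of
decreasing sequences.

Homogeneity (`IsPermLimit`) needs only one-point extensions. The limits are a point, `ℚ`, `ℚ × ℚ`
with two lexicographic orders, and `ℚ(√2)` under its two real embeddings. Reversing `<₁` supplies
the remaining two classes. -/

/-! ### Finite Ramsey theorem -/

/-- End-homogeneous sets, given the Ramsey property for `k`-subsets. -/
theorem exists_endHomogeneous {α : Type*} [LinearOrder α] (r k : ℕ)
    (ih : ∀ n : ℕ, ∃ N : ℕ, ∀ (χ : Finset α → Fin (r + 1)) (X : Finset α), N ≤ X.card →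
      ∃ i, ∃ Y ⊆ X, Y.card = n ∧ ∀ Z ⊆ Y, Z.card = k → χ Z = i) (m : ℕ) :
    ∃ N : ℕ, ∀ (χ : Finset α → Fin (r + 1)) (X : Finset α), N ≤ X.card →
      ∃ c : α → Fin (r + 1), ∃ Y ⊆ X, Y.card = m ∧
        ∀ Z ⊆ Y, Z.card = k + 1 → ∀ x ∈ Z, (∀ z ∈ Z, x ≤ z) → χ Z = c x := by
  induction m with
  | zero =>
    refine ⟨0, fun χ X _ => ⟨fun _ => 0, ∅, by simp, by simp, ?_⟩⟩
    intro Z hZ hc x hx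
    simp_all
  | succ m ihm =>
    obtain ⟨N, hN⟩ := ihm
    obtain ⟨R, hR⟩ := ih N
    refine ⟨R + 1, fun χ X hX => ?_⟩
    have hne : X.Nonempty := Finset.card_pos.1 (by omega)
    set a := X.min' hne with ha
    have haX : a ∈ X := X.min'_mem hne
    -- Make the colour of `insert a Z` independent of the `k`-subset `Z`, where `a` is the least
    -- point; that constant becomes the value of `c` at `a`.
    obtain ⟨i, X', hX', hX'c, hi⟩ := hR (fun Z => χ (insert a Z)) (X.erase a)
      (by rw [Finset.card_erase_of_mem haX]; omega)
    obtain ⟨c, Y, hY, hYc, hc⟩ := hN χ X' hX'c.ge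
    have haY : ∀ y ∈ Y, a < y := fun y hy => by
      have := hX' (hY hy)
      rw [Finset.mem_erase] at this
      exact lt_of_le_of_ne (X.min'_le _ this.2) this.1.symm
    have haY' : a ∉ Y := fun h => lt_irrefl _ (haY a h)
    refine ⟨Function.update c a i, insert a Y, ?_, by simp [haY', hYc], ?_⟩
    · intro y hy
      rcases Finset.mem_insert.1 hy with rfl | hy
      · exact haX
      · exact Finset.mem_of_mem_erase (hX' (hY hy))
    intro Z hZ hZc x hx hmin
    by_cases haZ : a ∈ Z
    · have hxa : x = a := by
        rcases Finset.mem_insert.1 (hZ hx) with h | h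
        · exact h
        · exact absurd (hmin a haZ) (not_le.2 (haY x h))
      have := hi (Z.erase a) (fun z hz => by
        rw [Finset.mem_erase] at hz
        exact hY ((Finset.mem_insert.1 (hZ hz.2)).resolve_left hz.1))
        (by rw [Finset.card_erase_of_mem haZ, hZc]; rfl)
      rw [Finset.insert_erase haZ] at this
      rw [hxa, Function.update_self, this]
    · have hZY : Z ⊆ Y := fun z hz =>
        (Finset.mem_insert.1 (hZ hz)).resolve_left (fun h => haZ (h ▸ hz))
      rw [hc Z hZY hZc x hx hmin, Function.update_of_ne]
      rintro rfl
      exact haZ hx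

/-- The finite Ramsey theorem for colourings of the `k`-subsets of a linear order. -/
theorem finite_ramsey_finset {α : Type*} [LinearOrder α] (r k n : ℕ) :
    ∃ N : ℕ, ∀ (χ : Finset α → Fin (r + 1)) (X : Finset α), N ≤ X.card →
      ∃ i, ∃ Y ⊆ X, Y.card = n ∧ ∀ Z ⊆ Y, Z.card = k → χ Z = i := by
  induction k generalizing n with
  | zero =>
    refine ⟨n, fun χ X hX => ?_⟩
    obtain ⟨Y, hY, hYc⟩ := Finset.exists_subset_card_eq hX
    refine ⟨χ ∅, Y, hY, hYc, fun Z _ hZ => ?_⟩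
    rw [Finset.card_eq_zero.1 hZ]
  | succ k ih =>
    obtain ⟨N, hN⟩ := exists_endHomogeneous (α := α) r k ih ((r + 1) * n)
    refine ⟨N, fun χ X hX => ?_⟩
    obtain ⟨c, Y, hY, hYc, hc⟩ := hN χ X hX
    -- The colour of a `(k + 1)`-set is now that of its least element, so pigeonhole on the `(r + 1)
    -- * n` points finishes.
    obtain ⟨i, -, hi⟩ := Finset.exists_le_card_fiber_of_mul_le_card_of_maps_to
      (s := Y) (t := Finset.univ) (f := c) (n := n) (fun _ _ => Finset.mem_univ _)
      Finset.univ_nonempty (by simp [hYc])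
    obtain ⟨Y', hY', hY'c⟩ := Finset.exists_subset_card_eq hi
    refine ⟨i, Y', fun y hy => hY (Finset.mem_filter.1 (hY' hy)).1, hY'c, fun Z hZ hZc => ?_⟩
    have hne : Z.Nonempty := Finset.card_pos.1 (by omega)
    rw [hc Z (fun z hz => (Finset.mem_filter.1 (hY' (hZ hz))).1) hZc (Z.min' hne)
      (Z.min'_mem hne) (fun z hz => Z.min'_le z hz)]
    exact (Finset.mem_filter.1 (hY' (hZ (Z.min'_mem hne)))).2

/-- The finite Ramsey theorem for colourings of the increasing maps from a finite linear order. -/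
theorem finite_ramsey_strictMono (W V : Type*) [LinearOrder W] [LinearOrder V] [Finite W]
    [Finite V] (r : ℕ) :
    ∃ N : ℕ, ∀ χ : (W → Fin N) → Fin (r + 1), ∃ e : V → Fin N, StrictMono e ∧
      ∃ i, ∀ g : W → V, StrictMono g → χ (e ∘ g) = i := by
  classical
  have := Fintype.ofFinite W
  have := Fintype.ofFinite V
  obtain ⟨N, hN⟩ := finite_ramsey_finset (α := ℕ) r (Fintype.card W) (Fintype.card V)
  refine ⟨N, fun χ => ?_⟩
  rcases isEmpty_or_nonempty (W → Fin N) with hemp | ⟨⟨f₀⟩⟩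
  · obtain ⟨i, Y, hYN, hYc, -⟩ := hN (fun _ => 0) (Finset.range N) (by simp)
    let e : V → Fin N := fun v =>
      ⟨Y.orderEmbOfFin hYc (Fintype.orderIsoFinOfCardEq V rfl |>.symm v),
      Finset.mem_range.1 (hYN (Y.orderEmbOfFin_mem hYc _))⟩
    refine ⟨e, fun a b hab => ?_, i, fun g => (hemp.false (e ∘ g)).elim⟩
    simpa [e] using hab
  -- A set of the size of `W` stands for its increasing enumeration; the value 0 on other sets is
  -- never used.
  let χ' : Finset ℕ → Fin (r + 1) := fun Z =>
    if h : Z.card = Fintype.card W ∧ Z ⊆ Finset.range N then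
      χ (fun w => ⟨Z.orderEmbOfFin h.1 (Fintype.orderIsoFinOfCardEq W rfl |>.symm w),
        Finset.mem_range.1 (h.2 (Z.orderEmbOfFin_mem h.1 _))⟩)
    else 0
  obtain ⟨i, Y, hYN, hYc, hi⟩ := hN χ' (Finset.range N) (by simp)
  let e : V → Fin N := fun v => ⟨Y.orderEmbOfFin hYc (Fintype.orderIsoFinOfCardEq V rfl |>.symm v),
    Finset.mem_range.1 (hYN (Y.orderEmbOfFin_mem hYc _))⟩
  have he : StrictMono e := fun a b hab => by simpa [e] using hab
  refine ⟨e, he, i, fun g hg => ?_⟩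
  have hinj : StrictMono (fun w => (e (g w) : ℕ)) := fun a b hab => he (hg hab)
  let Z : Finset ℕ := Finset.univ.image (fun w => (e (g w) : ℕ))
  have hZc : Z.card = Fintype.card W := by
    rw [Finset.card_image_of_injective _ hinj.injective, Finset.card_univ]
  have hZY : Z ⊆ Y := fun z hz => by
    obtain ⟨w, -, rfl⟩ := Finset.mem_image.1 hz
    exact Y.orderEmbOfFin_mem hYc _
  rw [← hi Z hZY hZc]
  have hcond : Z.card = Fintype.card W ∧ Z ⊆ Finset.range N := ⟨hZc, hZY.trans hYN⟩
  simp only [χ', dif_pos hcond]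
  congr 1
  funext w
  apply Fin.ext
  let σ := Fintype.orderIsoFinOfCardEq W rfl
  -- A finite set has only one increasing enumeration, so `e ∘ g` is the one used to colour its
  -- image.
  have huniq := Finset.orderEmbOfFin_unique hZc (f := fun j => (e (g (σ j)) : ℕ))
    (fun j => Finset.mem_image.2 ⟨σ j, Finset.mem_univ _, rfl⟩)
    (hinj.comp σ.strictMono)
  have := congrFun huniq (σ.symm w)
  simpa [σ] using this

/-! ### Permutations and their embeddings, elementarily -/

/-- The structure with prescribed interpretations of the two relation symbols. -/
@[reducible] def permStr {M : Type w} (lt : Fin 2 → M → M → Prop) : permLang.Structure M where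
  funMap := fun f => Empty.elim f
  RelMap := fun {n} R => match n, R with
    | _, PermRel.lt i => fun v => lt i (v 0) (v 1)

/-- A map preserving and reflecting both relations. -/
def IsPermEmb {A : Type u} {B : Type v} [permLang.Structure A] [permLang.Structure B]
    (f : A → B) : Prop :=
  ∀ i x y, permLt i (f x) (f y) ↔ permLt i x y

section

variable {A : Type u} {B : Type v} {C : Type w} [permLang.Structure A] [permLang.Structure B]
  [permLang.Structure C]

theorem IsPermEmb.comp {g : B → C} {f : A → B} (hg : IsPermEmb g) (hf : IsPermEmb f) :
    IsPermEmb (g ∘ f) := fun i x y => (hg i _ _).trans (hf i x y)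

theorem permLt_irrefl (hA : IsPermutation A) (i : Fin 2) (x : A) : ¬ permLt i x x :=
  (hA i).toIrrefl.irrefl x

theorem permLt_trans (hA : IsPermutation A) {i : Fin 2} {x y z : A} :
    permLt i x y → permLt i y z → permLt i x z :=
  (hA i).toIsTrans.trans x y z

theorem permLt_asymm (hA : IsPermutation A) {i : Fin 2} {x y : A} (h : permLt i x y) :
    ¬ permLt i y x := fun h' => permLt_irrefl hA i x (permLt_trans hA h h')

theorem permLt_trichotomy (hA : IsPermutation A) (i : Fin 2) (x y : A) :
    permLt i x y ∨ x = y ∨ permLt i y x := by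
  have := (hA i)
  exact trichotomous_of (permLt i) x y

/-- Distinct points are comparable in `<₀`; identifying them would, by reflection, put a point below
itself. This is why `IsPermEmb` need not include injectivity when the domain is a permutation. -/
theorem IsPermEmb.injective (hA : IsPermutation A) {f : A → B} (hf : IsPermEmb f) :
    Function.Injective f := by
  intro x y hxy
  rcases permLt_trichotomy hA 0 x y with h | h | h
  · have h1 := (hf 0 x y).2 h
    have h2 : permLt 0 (f x) (f x) := by rw [← hxy] at h1; exact h1
    exact absurd ((hf 0 x x).1 h2) (permLt_irrefl hA 0 x)
  · exact h
  · have h1 := (hf 0 y x).2 h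
    have h2 : permLt 0 (f x) (f x) := by rw [← hxy] at h1; exact h1
    exact absurd ((hf 0 x x).1 h2) (permLt_irrefl hA 0 x)

/-- Between permutations, preserving both orders is enough. -/
theorem IsPermEmb.of_imp (hA : IsPermutation A) (hB : IsPermutation B) {f : A → B}
    (h : ∀ i x y, permLt i x y → permLt i (f x) (f y)) : IsPermEmb f := by
  refine fun i x y => ⟨fun hxy => ?_, h i x y⟩
  rcases permLt_trichotomy hA i x y with h' | rfl | h'
  · exact h'
  · exact absurd hxy (permLt_irrefl hB i _)
  · exact absurd hxy (permLt_asymm hB (h i _ _ h'))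

theorem IsPermEmb.isPermutation {f : A → B} (hf : IsPermEmb f) (hinj : Function.Injective f)
    (hB : IsPermutation B) : IsPermutation A := fun i =>
  { trichotomous := fun x y h h' => by
      rw [← hf] at h h'
      rcases permLt_trichotomy hB i (f x) (f y) with h1 | h1 | h1
      · exact absurd h1 h
      · exact hinj h1
      · exact absurd h1 h'
    irrefl := fun x h => permLt_irrefl hB i _ ((hf i x x).2 h)
    trans := fun x y z h h' => (hf i x z).1
      (permLt_trans hB ((hf i x y).2 h) ((hf i y z).2 h')) }

theorem relMap_permLt (i : Fin 2) (x : Fin 2 → A) :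
    FirstOrder.Language.Structure.RelMap (L := permLang) (PermRel.lt i) x ↔
      permLt i (x 0) (x 1) := by
  have : x = ![x 0, x 1] := by ext j; fin_cases j <;> rfl
  unfold permLt
  rw [← this]

/-- The first-order embedding given by an injective map preserving and reflecting both
relations. -/
def IsPermEmb.toEmb {f : A → B} (hf : IsPermEmb f) (hinj : Function.Injective f) :
    A ↪[permLang] B where
  toFun := f
  inj' := hinj
  map_fun' := fun g => Empty.elim g
  map_rel' := fun {n} R x => by
    cases R with
    | lt i => exact (relMap_permLt i _).trans ((hf i _ _).trans (relMap_permLt i _).symm)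

theorem isPermEmb_of_emb (f : A ↪[permLang] B) : IsPermEmb f := fun i x y => by
  have := f.map_rel (PermRel.lt i) ![x, y]
  rw [relMap_permLt, relMap_permLt] at this
  exact this

theorem HasPattern.of_isPermEmb {f : A → B} (hf : IsPermEmb f) {n : ℕ} {p : Fin n → ℕ}
    (h : HasPattern A p) : HasPattern B p := by
  obtain ⟨x, hx⟩ := h
  exact ⟨f ∘ x, fun i j => ⟨(hf 0 _ _).trans (hx i j).1, (hf 1 _ _).trans (hx i j).2⟩⟩

end

theorem permStr_ext {M : Type w} (S T : permLang.Structure M)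
    (h : ∀ i x y, @permLt M S i x y ↔ @permLt M T i x y) : S = T := by
  apply FirstOrder.Language.Structure.ext
  · funext n f
    exact Empty.elim f
  · funext n R x
    cases R with
    | lt i => exact propext ((@relMap_permLt M S i x).trans ((h i _ _).trans
        (@relMap_permLt M T i x).symm))

/-- The permutation whose two orders are pulled back along `f` and `g`. -/
def permOf {M : Type w} {α β : Type*} [LinearOrder α] [LinearOrder β] (f : M → α) (g : M → β) :
    Bundled.{w} permLang.Structure :=
  ⟨M, permStr ![fun x y => f x < f y, fun x y => g x < g y]⟩

section

variable {M : Type w} {α β : Type*} [LinearOrder α] [LinearOrder β] {f : M → α} {g : M → β}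

theorem isPermutation_permOf (hf : Function.Injective f) (hg : Function.Injective g) :
    IsPermutation (permOf f g) := by
  intro i
  fin_cases i
  · exact
    { trichotomous := fun x y h h' => hf (le_antisymm (not_lt.1 h') (not_lt.1 h))
      irrefl := fun x => lt_irrefl (f x)
      trans := fun x y z => lt_trans (a := f x) (b := f y) (c := f z) }
  · exact
    { trichotomous := fun x y h h' => hg (le_antisymm (not_lt.1 h') (not_lt.1 h))
      irrefl := fun x => lt_irrefl (g x)
      trans := fun x y z => lt_trans (a := g x) (b := g y) (c := g z) }

end

/-- The subpermutation on a subset. -/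
def restr (P : Bundled.{w} permLang.Structure) (s : Set P) : Bundled.{w} permLang.Structure :=
  ⟨s, permStr fun i x y => permLt i (x : P) y⟩

theorem isPermEmb_restr (P : Bundled.{w} permLang.Structure) (s : Set P) :
    IsPermEmb (A := restr P s) (B := P) Subtype.val := fun _ _ _ => Iff.rfl

/-! ### Reversing the second order -/

/-- The permutation with the second order reversed. -/
def flipPerm (A : Bundled.{w} permLang.Structure) : Bundled.{w} permLang.Structure :=
  ⟨A, permStr ![fun x y => permLt 0 x y, fun x y => permLt 1 y x]⟩

theorem flipPerm_flipPerm (A : Bundled.{w} permLang.Structure) : flipPerm (flipPerm A) = A := by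
  obtain ⟨M, S⟩ := A
  have : (flipPerm (flipPerm ⟨M, S⟩)).str = S := by
    apply permStr_ext
    intro i x y
    fin_cases i <;> exact Iff.rfl
  exact congrArg (fun T => (⟨M, T⟩ : Bundled.{w} permLang.Structure)) this

theorem IsPermutation.flip {A : Bundled.{w} permLang.Structure} (hA : IsPermutation A) :
    IsPermutation (flipPerm A) := by
  intro i
  fin_cases i
  · exact hA 0
  · exact
    { trichotomous := fun x y h h' => (hA 1).toTrichotomous.trichotomous x y h' h
      irrefl := fun x => (hA 1).toIrrefl.irrefl x
      trans := fun x y z h h' => (hA 1).toIsTrans.trans z y x h' h }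

theorem IsPermEmb.flip {A B : Bundled.{w} permLang.Structure} {f : A → B} (hf : IsPermEmb f) :
    IsPermEmb (A := flipPerm A) (B := flipPerm B) f := by
  intro i x y
  fin_cases i
  · exact hf 0 x y
  · exact hf 1 y x

/-- Reversing `<₁` lists the same points from right to left. -/
theorem hasPattern_flipPerm {A : Bundled.{w} permLang.Structure} {n : ℕ} {p : Fin n → ℕ} :
    HasPattern (flipPerm A) p ↔ HasPattern A (p ∘ Fin.rev) := by
  constructor
  · rintro ⟨x, hx⟩
    refine ⟨x ∘ Fin.rev, fun i j => ⟨(hx i.rev j.rev).1, ?_⟩⟩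
    exact (hx j.rev i.rev).2.trans Fin.rev_lt_rev
  · rintro ⟨x, hx⟩
    refine ⟨x ∘ Fin.rev, fun i j => ⟨?_, ?_⟩⟩
    · have := (hx i.rev j.rev).1
      simp only [Function.comp_apply, Fin.rev_rev] at this
      exact this
    · exact (hx j.rev i.rev).2.trans Fin.rev_lt_rev

theorem mem_allPerms_flipPerm {A : Bundled.{w} permLang.Structure} :
    flipPerm A ∈ allPerms ↔ A ∈ allPerms :=
  ⟨fun h => ⟨h.1, by have := h.2.flip; rwa [flipPerm_flipPerm] at this⟩, fun h => ⟨h.1, h.2.flip⟩⟩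

theorem reversalPerms_eq :
    reversalPerms.{w} = {A | flipPerm A ∈ identityPerms} := by
  ext A
  refine and_congr mem_allPerms_flipPerm.symm ?_
  constructor
  · intro h x y
    exact h y x
  · intro h x y
    exact h y x

theorem decIncPerms_eq :
    decIncPerms.{w} = {A | flipPerm A ∈ incDecPerms} := by
  ext A
  refine and_congr mem_allPerms_flipPerm.symm ?_
  rw [hasPattern_flipPerm, hasPattern_flipPerm]
  have h1 : (![2, 3, 1] : Fin 3 → ℕ) ∘ Fin.rev = ![1, 3, 2] := by decide
  have h2 : (![3, 1, 2] : Fin 3 → ℕ) ∘ Fin.rev = ![2, 1, 3] := by decide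
  rw [h1, h2, and_comm]

/-! ### The Ramsey property in terms of maps -/

/-- The Ramsey property of a class of permutations, with colourings of all maps. -/
def HasRamseyProperty (K : Set (Bundled.{w} permLang.Structure)) : Prop :=
  ∀ A ∈ K, ∀ B ∈ K, ∀ r : ℕ, ∃ C ∈ K, ∀ χ : (A → C) → Fin (r + 1), ∃ (i : Fin (r + 1)) (e : B → C),
    IsPermEmb e ∧ ∀ f : A → B, IsPermEmb f → χ (e ∘ f) = i

theorem HasRamseyProperty.isRamseyClass {K : Set (Bundled.{w} permLang.Structure)}
    (hK : K ⊆ allPerms) (h : HasRamseyProperty K) : IsRamseyClass K := by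
  classical
  intro A hA B hB r
  cases r with
  -- With no colours there is no colouring to consider as soon as `A` embeds in `C`; `C = A`
  -- achieves this.
  | zero => exact ⟨A, hA, fun χ => (χ (Language.Embedding.refl permLang A)).elim0⟩
  | succ r =>
    obtain ⟨C, hC, hχ⟩ := h A hA B hB r
    refine ⟨C, hC, fun χ => ?_⟩
    -- Maps that are not embeddings get the dummy colour 0; only compositions of embeddings are
    -- evaluated later.
    obtain ⟨i, e, he, hi⟩ := hχ (fun f => if hf : IsPermEmb f then
      χ (hf.toEmb (hf.injective (hK hA).2)) else 0)
    let E := he.toEmb (he.injective (hK hB).2)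
    refine ⟨i, E.toHom.range, ⟨E.equivRange.symm⟩, fun f => ?_⟩
    let f' : A ↪[permLang] B := E.equivRange.symm.toEmbedding.comp f
    have hf' : IsPermEmb f' := isPermEmb_of_emb f'
    have := hi f' hf'
    rw [dif_pos (he.comp hf')] at this
    rw [← this]
    congr 1
    ext x
    have h1 : E.equivRange (E.equivRange.symm (f x)) = f x := E.equivRange.apply_symm_apply _
    have h2 := congrArg Subtype.val h1
    rw [Language.Embedding.equivRange_apply] at h2
    exact h2.symm

theorem IsRamseyClass.hasRamseyProperty {K : Set (Bundled.{w} permLang.Structure)}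
    (hK : K ⊆ allPerms) (h : IsRamseyClass K) : HasRamseyProperty K := by
  intro A hA B hB r
  obtain ⟨C, hC, hχ⟩ := h A hA B hB (r + 1)
  refine ⟨C, hC, fun χ => ?_⟩
  obtain ⟨i, B', ⟨φ⟩, hi⟩ := hχ (fun f => χ f)
  refine ⟨i, fun b => φ.symm b, fun j x y => ?_, fun f hf => ?_⟩
  · exact isPermEmb_of_emb (B'.subtype.comp φ.symm.toEmbedding) j x y
  · exact hi (φ.symm.toEmbedding.comp (hf.toEmb (hf.injective (hK hA).2)))

/-- Flipping changes neither the underlying sets nor which maps are embeddings, so a colouring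
transfers verbatim. -/
theorem HasRamseyProperty.flip {K : Set (Bundled.{w} permLang.Structure)}
    (h : HasRamseyProperty K) : HasRamseyProperty {A | flipPerm A ∈ K} := by
  intro A hA B hB r
  obtain ⟨C, hC, hχ⟩ := h _ hA _ hB r
  refine ⟨flipPerm C, by simpa [flipPerm_flipPerm] using hC, fun χ => ?_⟩
  obtain ⟨i, e, he, hi⟩ := hχ χ
  refine ⟨i, e, ?_, fun f hf => hi f hf.flip⟩
  intro j x y
  fin_cases j
  · exact he 0 x y
  · exact he 1 y x

/-- The increasing map between ranges induced by an order-compatible pair of maps. -/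
theorem exists_strictMono_range {A : Type u} {B : Type v} (a : A → ℕ) (b : B → ℕ) (f : A → B)
    (h : ∀ x y, a x < a y ↔ b (f x) < b (f y)) :
    ∃ g : Set.range a → Set.range b, StrictMono g ∧
      ∀ x, g ⟨a x, x, rfl⟩ = ⟨b (f x), f x, rfl⟩ := by
  have hg : ∀ x y, a x = a y → b (f x) = b (f y) := fun x y hxy => by
    have h1 := h x y
    have h2 := h y x
    omega
  choose s hs using fun t : Set.range a => t.2
  refine ⟨fun t => ⟨b (f (s t)), f (s t), rfl⟩, fun t t' htt' => ?_, fun x => Subtype.ext ?_⟩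
  · have : a (s t) < a (s t') := by rw [hs, hs]; exact htt'
    exact (h _ _).1 this
  · exact hg _ _ (hs ⟨a x, x, rfl⟩)

/-- If the members of `K` are coded, compatibly with embeddings, by two rank functions, and every
pair of increasing choices of ranks is realised by an embedding into a fixed member of `K`, then
`K` has the Ramsey property: colour the increasing sequences listing first the values of the first
rank function and then those of the second. -/
theorem hasRamseyProperty_of_coding {K : Set (Bundled.{w} permLang.Structure)}
    (hfin : K ⊆ allPerms)
    (a b : ∀ A : Bundled.{w} permLang.Structure, A → ℕ)
    (ha : ∀ A ∈ K, ∀ B ∈ K, ∀ f : A → B, IsPermEmb f →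
      ∀ x y, a A x < a A y ↔ a B (f x) < a B (f y))
    (hb : ∀ A ∈ K, ∀ B ∈ K, ∀ f : A → B, IsPermEmb f →
      ∀ x y, b A x < b A y ↔ b B (f x) < b B (f y))
    (C : ℕ → Bundled.{w} permLang.Structure) (hC : ∀ N, C N ∈ K)
    (κ : ∀ N, Fin N → Fin N → C N)
    (hκ : ∀ N, ∀ A ∈ K, ∀ s t : A → Fin N, (∀ x y, a A x < a A y ↔ s x < s y) →
      (∀ x y, b A x < b A y ↔ t x < t y) → IsPermEmb (fun x => κ N (s x) (t x))) :
    HasRamseyProperty K := by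
  intro A hA B hB r
  have := (hfin hA).1
  have := (hfin hB).1
  have hWA : Finite (Lex (Set.range (a A) ⊕ Set.range (b A))) :=
    inferInstanceAs (Finite (Set.range (a A) ⊕ Set.range (b A)))
  have hWB : Finite (Lex (Set.range (a B) ⊕ Set.range (b B))) :=
    inferInstanceAs (Finite (Set.range (a B) ⊕ Set.range (b B)))
  -- Placing the second ranks after the first in a lexicographic sum replaces a product Ramsey
  -- argument by one use of the ordinary theorem.
  obtain ⟨N, hN⟩ := finite_ramsey_strictMono (Lex (Set.range (a A) ⊕ Set.range (b A)))
    (Lex (Set.range (a B) ⊕ Set.range (b B))) r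
  refine ⟨C N, hC N, fun χ => ?_⟩
  -- An increasing sequence decodes to a map into `C N`: the two entries belonging to a point are
  -- combined by `κ`.
  obtain ⟨e, he, i, hi⟩ := hN (fun e => χ (fun x =>
    κ N (e (Sum.inlₗ ⟨a A x, x, rfl⟩)) (e (Sum.inrₗ ⟨b A x, x, rfl⟩))))
  refine ⟨i, fun x => κ N (e (Sum.inlₗ ⟨a B x, x, rfl⟩)) (e (Sum.inrₗ ⟨b B x, x, rfl⟩)), ?_, ?_⟩
  · apply hκ N B hB
    · intro x y
      rw [he.lt_iff_lt, Sum.Lex.inl_lt_inl_iff]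
      exact Iff.rfl
    · intro x y
      rw [he.lt_iff_lt, Sum.Lex.inr_lt_inr_iff]
      exact Iff.rfl
  · intro f hf
    obtain ⟨g₁, hg₁, hg₁'⟩ := exists_strictMono_range (a A) (a B) f (ha A hA B hB f hf)
    obtain ⟨g₂, hg₂, hg₂'⟩ := exists_strictMono_range (b A) (b B) f (hb A hA B hB f hf)
    -- An embedding `f` acts increasingly on each list of ranks, hence on the sum; so `f` followed
    -- by the decoded copy of `B` is the decoding of a subsequence of `e`.
    have hg : StrictMono (fun z : Lex (Set.range (a A) ⊕ Set.range (b A)) =>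
        (toLex (Sum.map g₁ g₂ (ofLex z)) : Lex (Set.range (a B) ⊕ Set.range (b B)))) := by
      intro z z' hzz'
      induction z using Lex.rec with | _ z => ?_
      induction z' using Lex.rec with | _ z' => ?_
      rcases z with z | z <;> rcases z' with z' | z'
      · exact Sum.Lex.inl_lt_inl_iff.2 (hg₁ (Sum.Lex.inl_lt_inl_iff.1 hzz'))
      · exact Sum.Lex.inl_lt_inr _ _
      · exact absurd hzz' Sum.Lex.not_inr_lt_inl
      · exact Sum.Lex.inr_lt_inr_iff.2 (hg₂ (Sum.Lex.inr_lt_inr_iff.1 hzz'))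
    rw [← hi _ hg]
    congr 1
    funext x
    have h1 := hg₁' x
    have h2 := hg₂' x
    simp only [Function.comp_apply, Sum.inlₗ, Sum.inrₗ, ofLex_toLex, Sum.map_inl, Sum.map_inr,
      h1, h2]

/-- The rank of `x` with respect to `<ᵢ`. -/
noncomputable def permRank {A : Type u} [permLang.Structure A] (i : Fin 2) (x : A) : ℕ :=
  {y : A | permLt i y x}.ncard

theorem permRank_lt_iff {A : Type u} [permLang.Structure A] [Finite A] (hA : IsPermutation A)
    (i : Fin 2) (x y : A) : permRank i x < permRank i y ↔ permLt i x y := by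
  have key : ∀ x y : A, permLt i x y → permRank i x < permRank i y := fun x y h =>
    Set.ncard_lt_ncard ⟨fun z hz => permLt_trans hA hz h, fun hs =>
      permLt_irrefl hA i x (hs h)⟩ (Set.toFinite _)
  refine ⟨fun h => ?_, key x y⟩
  rcases permLt_trichotomy hA i x y with h' | rfl | h'
  · exact h'
  · omega
  · have := key y x h'
    omega

theorem hasRamseyProperty_trivialPerms : HasRamseyProperty trivialPerms.{w} := by
  refine hasRamseyProperty_of_coding (fun A h => h.1) (fun _ _ => 0) (fun _ _ => 0)
    (fun _ _ _ _ _ _ _ _ => Iff.rfl) (fun _ _ _ _ _ _ _ _ => Iff.rfl)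
    (fun _ => permOf (M := PUnit) (fun _ => 0) (fun _ => 0))
    (fun _ => ⟨⟨inferInstanceAs (Finite PUnit), isPermutation_permOf
      (Function.injective_of_subsingleton _) (Function.injective_of_subsingleton _)⟩,
      inferInstanceAs (Subsingleton PUnit)⟩) (fun _ _ _ => PUnit.unit) ?_
  intro N A hA s t _ _ i x y
  have := hA.2
  rw [Subsingleton.elim y x]
  exact ⟨fun h => absurd h (permLt_irrefl (isPermutation_permOf
      (Function.injective_of_subsingleton _) (Function.injective_of_subsingleton _)) i _),
    fun h => absurd h (permLt_irrefl hA.1.2 i x)⟩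

theorem hasRamseyProperty_identityPerms : HasRamseyProperty identityPerms.{w} := by
  refine hasRamseyProperty_of_coding (fun A h => h.1) (fun A x => permRank 0 x)
    (fun A x => permRank 0 x) ?_ ?_
    (fun N => permOf (M := ULift (Fin N)) ULift.down ULift.down)
    (fun N => ⟨⟨inferInstanceAs (Finite (ULift (Fin N))),
      isPermutation_permOf ULift.down_injective ULift.down_injective⟩, fun _ _ => Iff.rfl⟩)
    (fun N s _ => ULift.up s) ?_
  iterate 2
    intro A hA B hB f hf x y
    have := hA.1.1
    have := hB.1.1
    rw [permRank_lt_iff hA.1.2, permRank_lt_iff hB.1.2, hf]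
  intro N A hA s t hs _ i x y
  have := hA.1.1
  have h0 : s x < s y ↔ permLt 0 x y := by rw [← hs, permRank_lt_iff hA.1.2]
  fin_cases i
  · exact h0
  · exact h0.trans (hA.2 x y).symm

/-- The grid of pairs, ordered lexicographically with either coordinate first. -/
def gridPerm (N : ℕ) : Bundled.{w} permLang.Structure :=
  permOf (M := ULift.{w} (Fin N × Fin N)) (fun z => toLex (z.down.1, z.down.2))
    (fun z => toLex (z.down.2, z.down.1))

theorem isPermutation_gridPerm (N : ℕ) : IsPermutation (gridPerm.{w} N) := by
  apply isPermutation_permOf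
  all_goals
    rintro ⟨x⟩ ⟨y⟩ h
    have := toLex.injective h
    simp_all [Prod.ext_iff]

/-- The ranks in the two orders determine a permutation. Distinct points differ in both coordinates
of the grid, so each order is decided by its leading coordinate; the lexicographic tie-break only
makes the grid itself a permutation. -/
theorem hasRamseyProperty_allPerms : HasRamseyProperty allPerms.{w} := by
  refine hasRamseyProperty_of_coding (fun A h => h) (fun A x => permRank 0 x)
    (fun A x => permRank 1 x) ?_ ?_ gridPerm
    (fun N => ⟨inferInstanceAs (Finite (ULift (Fin N × Fin N))), isPermutation_gridPerm N⟩)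
    (fun N s t => ULift.up (s, t)) ?_
  iterate 2
    intro A hA B hB f hf x y
    have := hA.1
    have := hB.1
    rw [permRank_lt_iff hA.2, permRank_lt_iff hB.2, hf]
  intro N A hA s t hs ht
  have := hA.1
  have h0 : ∀ x y, s x < s y ↔ permLt 0 x y := fun x y => by rw [← hs, permRank_lt_iff hA.2]
  have h1 : ∀ x y, t x < t y ↔ permLt 1 x y := fun x y => by rw [← ht, permRank_lt_iff hA.2]
  refine IsPermEmb.of_imp hA.2 (isPermutation_gridPerm N) fun i x y hxy => ?_
  fin_cases i
  · exact Prod.Lex.toLex_lt_toLex.2 (Or.inl ((h0 x y).2 hxy))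
  · exact Prod.Lex.toLex_lt_toLex.2 (Or.inl ((h1 x y).2 hxy))

/-! ### Increasing sequences of decreasing sequences -/

/-- `x` lies below `y` in both orders. -/
def PermBelow {A : Type u} [permLang.Structure A] (x y : A) : Prop :=
  permLt 0 x y ∧ permLt 1 x y

/-- Three points listed increasingly in `<₁` with prescribed order in `<₀`. -/
theorem hasPattern_three {A : Type u} [permLang.Structure A] (hA : IsPermutation A)
    (x : Fin 3 → A) (p : Fin 3 → ℕ) (h01 : permLt 1 (x 0) (x 1)) (h12 : permLt 1 (x 1) (x 2))
    (hp : ∀ i j, p i < p j → permLt 0 (x i) (x j)) (hinj : Function.Injective p) :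
    HasPattern A p := by
  have h02 := permLt_trans hA h01 h12
  have key : ∀ i j : Fin 3, i < j → permLt 1 (x i) (x j) := by
    intro i j hij
    fin_cases i <;> fin_cases j <;> first | exact absurd hij (by decide) | assumption
  refine ⟨x, fun i j => ⟨⟨fun h => ?_, hp i j⟩, ⟨fun h => ?_, key i j⟩⟩⟩
  · by_contra hn
    rcases eq_or_lt_of_le (not_lt.1 hn) with h' | h'
    · rw [hinj h'] at h
      exact permLt_irrefl hA 0 _ h
    · exact permLt_asymm hA h (hp j i h')
  · by_contra hn
    rcases eq_or_lt_of_le (not_lt.1 hn) with h' | h'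
    · rw [h'] at h
      exact permLt_irrefl hA 1 _ h
    · exact permLt_asymm hA h (key j i h')

theorem hasPattern_231 {A : Type u} [permLang.Structure A] (hA : IsPermutation A) {x y z : A}
    (h01 : permLt 1 x y) (h12 : permLt 1 y z) (h : permLt 0 z x) (h' : permLt 0 x y) :
    HasPattern A ![2, 3, 1] := by
  refine hasPattern_three hA ![x, y, z] _ h01 h12 (fun i j hij => ?_) (by decide)
  have h'' := permLt_trans hA h h'
  fin_cases i <;> fin_cases j <;> first | exact absurd hij (by decide) | assumption

theorem hasPattern_312 {A : Type u} [permLang.Structure A] (hA : IsPermutation A) {x y z : A}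
    (h01 : permLt 1 x y) (h12 : permLt 1 y z) (h : permLt 0 y z) (h' : permLt 0 z x) :
    HasPattern A ![3, 1, 2] := by
  refine hasPattern_three hA ![x, y, z] _ h01 h12 (fun i j hij => ?_) (by decide)
  have h'' := permLt_trans hA h h'
  fin_cases i <;> fin_cases j <;> first | exact absurd hij (by decide) | assumption

section

variable {A : Type u} [permLang.Structure A]

theorem PermBelow.trans (hA : IsPermutation A) {x y z : A} (h : PermBelow x y)
    (h' : PermBelow y z) : PermBelow x z :=
  ⟨permLt_trans hA h.1 h'.1, permLt_trans hA h.2 h'.2⟩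

/-- Two incomparable points form a descent. -/
theorem descent_of_not_permBelow (hA : IsPermutation A) {x y : A} (h : ¬ PermBelow x y)
    (h' : ¬ PermBelow y x) :
    x = y ∨ (permLt 0 x y ∧ permLt 1 y x) ∨ (permLt 0 y x ∧ permLt 1 x y) := by
  rcases permLt_trichotomy hA 0 x y with h0 | h0 | h0 <;>
    rcases permLt_trichotomy hA 1 x y with h1 | h1 | h1 <;>
    simp_all [PermBelow]

/-- Incomparable points form a descent; a third point below only one of them would complete it to
231 or 312. Together with its mirror image this makes incomparability an equivalence relation, whose
classes are the decreasing blocks. -/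
theorem permBelow_of_permBelow_left (hA : IsPermutation A) (h1 : ¬ HasPattern A ![2, 3, 1])
    (h2 : ¬ HasPattern A ![3, 1, 2]) {x y z : A} (h : ¬ PermBelow x y) (h' : ¬ PermBelow y x)
    (hz : PermBelow z x) : PermBelow z y := by
  rcases descent_of_not_permBelow hA h h' with rfl | ⟨h3, h4⟩ | ⟨h3, h4⟩
  · exact hz
  · have hzy := permLt_trans hA hz.1 h3
    refine ⟨hzy, ?_⟩
    rcases permLt_trichotomy hA 1 z y with h5 | rfl | h5
    · exact h5
    · exact absurd hzy (permLt_irrefl hA 0 _)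
    · exact absurd (hasPattern_312 hA h5 hz.2 hz.1 h3) h2
  · have hzy := permLt_trans hA hz.2 h4
    refine ⟨?_, hzy⟩
    rcases permLt_trichotomy hA 0 z y with h5 | rfl | h5
    · exact h5
    · exact absurd hzy (permLt_irrefl hA 1 _)
    · exact absurd (hasPattern_231 hA hz.2 h4 h5 hz.1) h1

theorem permBelow_of_permBelow_right (hA : IsPermutation A) (h1 : ¬ HasPattern A ![2, 3, 1])
    (h2 : ¬ HasPattern A ![3, 1, 2]) {x y z : A} (h : ¬ PermBelow x y) (h' : ¬ PermBelow y x)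
    (hz : PermBelow x z) : PermBelow y z := by
  rcases descent_of_not_permBelow hA h h' with rfl | ⟨h3, h4⟩ | ⟨h3, h4⟩
  · exact hz
  · have hyz := permLt_trans hA h4 hz.2
    refine ⟨?_, hyz⟩
    rcases permLt_trichotomy hA 0 y z with h5 | rfl | h5
    · exact h5
    · exact absurd hyz (permLt_irrefl hA 1 _)
    · exact absurd (hasPattern_312 hA h4 hz.2 hz.1 h5) h2
  · have hyz := permLt_trans hA h3 hz.1
    refine ⟨hyz, ?_⟩
    rcases permLt_trichotomy hA 1 y z with h5 | rfl | h5
    · exact h5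
    · exact absurd hyz (permLt_irrefl hA 0 _)
    · exact absurd (hasPattern_231 hA hz.2 h5 h3 hz.1) h1

/-- The number of points below `x`, which depends only on the decreasing block of `x`. -/
noncomputable def blockRank (x : A) : ℕ := {y : A | PermBelow y x}.ncard

/-- Incomparable points have the same points below them, so equal rank; comparable ones have
strictly nested sets of points below. -/
theorem blockRank_lt_iff [Finite A] (hA : IsPermutation A) (h1 : ¬ HasPattern A ![2, 3, 1])
    (h2 : ¬ HasPattern A ![3, 1, 2]) (x y : A) : blockRank x < blockRank y ↔ PermBelow x y := by
  have key : ∀ x y : A, PermBelow x y → blockRank x < blockRank y := fun x y h =>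
    Set.ncard_lt_ncard ⟨fun z hz => PermBelow.trans hA hz h, fun hs =>
      permLt_irrefl hA 0 x (hs h : PermBelow x x).1⟩ (Set.toFinite _)
  refine ⟨fun h => ?_, key x y⟩
  by_contra hn
  by_cases hn' : PermBelow y x
  · have := key y x hn'
    omega
  · have : {z : A | PermBelow z x} = {z | PermBelow z y} := Set.ext fun z =>
      ⟨permBelow_of_permBelow_left hA h1 h2 hn hn', permBelow_of_permBelow_left hA h1 h2 hn' hn⟩
    unfold blockRank at h
    rw [this] at h
    omega

end

/-- The increasing sequence, indexed by `α`, of decreasing sequences indexed by `β`. -/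
def lexPerm (α β : Type) [LinearOrder α] [LinearOrder β] : Bundled.{w} permLang.Structure :=
  permOf (M := ULift.{w} (α × β)) (fun z => toLex (z.down.1, z.down.2))
    (fun z => toLex (z.down.1, OrderDual.toDual z.down.2))

section

variable {α β : Type} [LinearOrder α] [LinearOrder β]

theorem isPermutation_lexPerm : IsPermutation (lexPerm.{w} α β) := by
  apply isPermutation_permOf
  all_goals
    rintro ⟨x⟩ ⟨y⟩ h
    have := toLex.injective h
    simp_all [Prod.ext_iff]

theorem permLt_zero_lexPerm {x y : ULift.{w} (α × β)} : permLt (M := lexPerm.{w} α β) 0 x y ↔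
    x.down.1 < y.down.1 ∨ x.down.1 = y.down.1 ∧ x.down.2 < y.down.2 :=
  Prod.Lex.toLex_lt_toLex

theorem permLt_one_lexPerm {x y : ULift.{w} (α × β)} : permLt (M := lexPerm.{w} α β) 1 x y ↔
    x.down.1 < y.down.1 ∨ x.down.1 = y.down.1 ∧ y.down.2 < x.down.2 :=
  Prod.Lex.toLex_lt_toLex

theorem lexPerm_not_hasPattern_231 : ¬ HasPattern (lexPerm.{w} α β) ![2, 3, 1] := by
  rintro ⟨x, hx⟩
  have h1 := permLt_one_lexPerm.1 ((hx 0 1).2.2 (by decide))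
  have h2 := permLt_one_lexPerm.1 ((hx 1 2).2.2 (by decide))
  have h3 := permLt_zero_lexPerm.1 ((hx 2 0).1.2 (by decide))
  have h4 := permLt_zero_lexPerm.1 ((hx 0 1).1.2 (by decide))
  grind

theorem lexPerm_not_hasPattern_312 : ¬ HasPattern (lexPerm.{w} α β) ![3, 1, 2] := by
  rintro ⟨x, hx⟩
  have h1 := permLt_one_lexPerm.1 ((hx 0 1).2.2 (by decide))
  have h2 := permLt_one_lexPerm.1 ((hx 1 2).2.2 (by decide))
  have h3 := permLt_zero_lexPerm.1 ((hx 1 2).1.2 (by decide))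
  have h4 := permLt_zero_lexPerm.1 ((hx 2 0).1.2 (by decide))
  grind

end

/-- Block number and `<₀`-rank form the code. Points of different blocks are ordered by the first
coordinate; within a block the first coordinates agree and the `<₀`-rank decides, read backwards for
`<₁`. -/
theorem hasRamseyProperty_incDecPerms : HasRamseyProperty incDecPerms.{w} := by
  refine hasRamseyProperty_of_coding (fun A h => h.1) (fun A x => blockRank x)
    (fun A x => permRank 0 x) ?_ ?_ (fun N => lexPerm (Fin N) (Fin N))
    (fun N => ⟨⟨inferInstanceAs (Finite (ULift (Fin N × Fin N))), isPermutation_lexPerm⟩,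
      lexPerm_not_hasPattern_231, lexPerm_not_hasPattern_312⟩)
    (fun N s t => ULift.up (s, t)) ?_
  · intro A hA B hB f hf x y
    have := hA.1.1
    have := hB.1.1
    rw [blockRank_lt_iff hA.1.2 hA.2.1 hA.2.2, blockRank_lt_iff hB.1.2 hB.2.1 hB.2.2]
    exact (and_congr (hf 0 x y) (hf 1 x y)).symm
  · intro A hA B hB f hf x y
    have := hA.1.1
    have := hB.1.1
    rw [permRank_lt_iff hA.1.2, permRank_lt_iff hB.1.2, hf]
  intro N A hA s t hs ht
  have := hA.1.1
  have h0 : ∀ x y, s x < s y ↔ PermBelow x y := fun x y => by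
    rw [← hs, blockRank_lt_iff hA.1.2 hA.2.1 hA.2.2]
  have h1 : ∀ x y, t x < t y ↔ permLt 0 x y := fun x y => by rw [← ht, permRank_lt_iff hA.1.2]
  have heq : ∀ x y, ¬ PermBelow x y → ¬ PermBelow y x → s x = s y := fun x y h h' =>
    le_antisymm (not_lt.1 fun hlt => h' ((h0 _ _).1 hlt)) (not_lt.1 fun hlt => h ((h0 _ _).1 hlt))
  refine IsPermEmb.of_imp hA.1.2 isPermutation_lexPerm fun i x y hxy => ?_
  by_cases hb : PermBelow x y
  · fin_cases i
    · exact permLt_zero_lexPerm.2 (Or.inl ((h0 x y).2 hb))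
    · exact permLt_one_lexPerm.2 (Or.inl ((h0 x y).2 hb))
  · fin_cases i
    · have hb' : ¬ PermBelow y x := fun h => permLt_asymm hA.1.2 hxy h.1
      exact permLt_zero_lexPerm.2 (Or.inr ⟨heq x y hb hb', (h1 x y).2 hxy⟩)
    · have hb' : ¬ PermBelow y x := fun h => permLt_asymm hA.1.2 hxy h.2
      refine permLt_one_lexPerm.2 (Or.inr ⟨heq x y hb hb', (h1 y x).2 ?_⟩)
      rcases descent_of_not_permBelow hA.1.2 hb hb' with rfl | h | h
      · exact absurd hxy (permLt_irrefl hA.1.2 1 _)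
      · exact absurd h.2 (permLt_asymm hA.1.2 hxy)
      · exact h.1

/-! ### Homogeneous permutations from one-point extensions -/

/-- `M` is a countable permutation whose finite subpermutations lie in `K` and in which every
one-point extension prescribed by a member of `K` is realised. -/
structure IsPermLimit (K : Set (Bundled.{w} permLang.Structure))
    (M : Bundled.{w} permLang.Structure) : Prop where
  countable : Countable M
  nonempty : Nonempty M
  isPermutation : IsPermutation M
  mem_of_emb : ∀ P : Bundled.{w} permLang.Structure, Finite P → ∀ f : P → M, IsPermEmb f →
    Function.Injective f → P ∈ K
  extend : ∀ P ∈ K, ∀ (s : Set P) (a : P) (h : P → M), a ∉ s →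
    (∀ i, ∀ x ∈ s, ∀ y ∈ s, permLt i (h x) (h y) ↔ permLt i x y) →
    ∃ m : M, ∀ i, ∀ x ∈ s, (permLt i x a → permLt i (h x) m) ∧ (permLt i a x → permLt i m (h x))

section

variable {K : Set (Bundled.{w} permLang.Structure)} {M : Bundled.{w} permLang.Structure}

/-- Preserving both orders is enough, since reflection follows by trichotomy. Values of `h` outside
`s` are irrelevant, which lets total maps stand for partial ones. -/
theorem IsPermLimit.extend_update (hM : IsPermLimit K M) (hK : K ⊆ allPerms)
    {P : Bundled.{w} permLang.Structure} (hP : P ∈ K) (s : Set P) (a : P) (h : P → M)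
    (hs : ∀ i, ∀ x ∈ s, ∀ y ∈ s, permLt i (h x) (h y) ↔ permLt i x y) :
    ∃ h' : P → M, (∀ x ∈ s, h' x = h x) ∧
      ∀ i, ∀ x ∈ insert a s, ∀ y ∈ insert a s, permLt i (h' x) (h' y) ↔ permLt i x y := by
  classical
  by_cases ha : a ∈ s
  · exact ⟨h, fun _ _ => rfl, by rwa [Set.insert_eq_of_mem ha]⟩
  obtain ⟨m, hm⟩ := hM.extend P hP s a h ha hs
  have hne : ∀ x ∈ s, x ≠ a := fun x hx hxa => ha (hxa ▸ hx)
  have key : ∀ i, ∀ x ∈ insert a s, ∀ y ∈ insert a s, permLt i x y →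
      permLt i (Function.update h a m x) (Function.update h a m y) := by
    intro i x hx y hy hxy
    rcases hx with rfl | hx <;> rcases hy with rfl | hy
    · exact absurd hxy (permLt_irrefl (hK hP).2 i _)
    · rw [Function.update_self, Function.update_of_ne (hne y hy)]
      exact (hm i y hy).2 hxy
    · rw [Function.update_self, Function.update_of_ne (hne x hx)]
      exact (hm i x hx).1 hxy
    · rw [Function.update_of_ne (hne x hx), Function.update_of_ne (hne y hy)]
      exact (hs i x hx y hy).2 hxy
  refine ⟨Function.update h a m, fun x hx => Function.update_of_ne (hne x hx) _ _,
    fun i x hx y hy => ⟨fun h' => ?_, key i x hx y hy⟩⟩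
  rcases permLt_trichotomy (hK hP).2 i x y with h1 | rfl | h1
  · exact h1
  · exact absurd h' (permLt_irrefl hM.isPermutation i _)
  · exact absurd h' (permLt_asymm hM.isPermutation (key i y hy x hx h1))

theorem IsPermLimit.exists_emb (hM : IsPermLimit K M) (hK : K ⊆ allPerms)
    {P : Bundled.{w} permLang.Structure} (hP : P ∈ K) : ∃ f : P → M, IsPermEmb f := by
  have hfin := (hK hP).1
  obtain ⟨m₀⟩ := hM.nonempty
  have : ∀ s : Set P, s.Finite → ∃ h : P → M,
      ∀ i, ∀ x ∈ s, ∀ y ∈ s, permLt i (h x) (h y) ↔ permLt i x y := by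
    intro s hs
    induction s, hs using Set.Finite.induction_on with
    | empty => exact ⟨fun _ => m₀, by simp⟩
    | insert _ _ ih =>
      obtain ⟨h, hh⟩ := ih
      obtain ⟨h', -, hh'⟩ := hM.extend_update hK hP _ _ h hh
      exact ⟨h', hh'⟩
  obtain ⟨h, hh⟩ := this Set.univ (Set.toFinite _)
  exact ⟨h, fun i x y => hh i x trivial y trivial⟩

theorem IsPermLimit.age_eq (hM : IsPermLimit K M) (hK : K ⊆ allPerms) :
    permLang.age M = K := by
  ext P
  constructor
  · rintro ⟨hfg, ⟨f⟩⟩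
    exact hM.mem_of_emb P (Language.Structure.fg_iff_finite.1 hfg) f
      (isPermEmb_of_emb f) f.injective
  · intro hP
    obtain ⟨f, hf⟩ := hM.exists_emb hK hP
    exact ⟨Language.Structure.fg_iff_finite.2 (hK hP).1, ⟨hf.toEmb (hf.injective (hK hP).2)⟩⟩

/-- Back-and-forth on a countable structure asks only that a finite partial embedding extend to one
more point. The substructure spanned by domain and new point lies in `K`, so the extension property
applies. -/
theorem IsPermLimit.isUltrahomogeneous (hM : IsPermLimit K M) (hK : K ⊆ allPerms) :
    permLang.IsUltrahomogeneous M := by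
  have := hM.countable
  rw [Language.isUltrahomogeneous_iff_IsExtensionPair Language.Structure.cg_of_countable,
    Language.isExtensionPair_iff_exists_embedding_closure_singleton_sup]
  intro S hS f m
  set T : permLang.Substructure M := Language.Substructure.closure permLang {m} ⊔ S with hT
  have hTfin : Finite T :=
    Language.Substructure.FG.finite ((Language.Substructure.fg_closure_singleton m).sup hS)
  have hST : S ≤ T := le_sup_right
  have hmT : m ∈ T := (le_sup_left : _ ≤ T)
    (Language.Substructure.subset_closure (Set.mem_singleton m))
  have hTK : (⟨T, inferInstance⟩ : Bundled.{w} permLang.Structure) ∈ K :=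
    hM.mem_of_emb ⟨T, inferInstance⟩ hTfin T.subtype
    (isPermEmb_of_emb T.subtype) T.subtype.injective
  have hTval : ∀ i (x y : T), permLt i (x : M) y ↔ permLt i x y :=
    fun i x y => isPermEmb_of_emb T.subtype i x y
  classical
  obtain ⟨h', hh', hemb⟩ := hM.extend_update hK hTK {x : T | (x : M) ∈ S} ⟨m, hmT⟩
    (fun x => if hx : (x : M) ∈ S then f ⟨x, hx⟩ else m) (by
      intro i x hx y hy
      simp only [Set.mem_ofPred_eq] at hx hy
      rw [dif_pos hx, dif_pos hy, isPermEmb_of_emb f i, ← hTval]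
      exact (isPermEmb_of_emb S.subtype i _ _).symm)
  -- The language is relational, so generating with `m` adds no point but `m`.
  have huniv : ∀ x : T, x ∈ insert (⟨m, hmT⟩ : T) {x : T | (x : M) ∈ S} := by
    rintro ⟨x, hx⟩
    have hx' : x ∈ (Language.Substructure.closure permLang ({m} ∪ (S : Set M)) : Set M) := by
      rw [Language.Substructure.closure_union, Language.Substructure.closure_eq]
      exact hx
    rw [Language.Substructure.closure_eq_of_isRelational] at hx'
    rcases hx' with hx' | hx'
    · exact Or.inl (Subtype.ext hx')
    · exact Or.inr hx'
  have hemb' : IsPermEmb h' := fun i x y => hemb i x (huniv x) y (huniv y)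
  refine ⟨hemb'.toEmb (hemb'.injective (hK hTK).2), ?_⟩
  ext x
  have := hh' ⟨x, hST x.2⟩ x.2
  rw [dif_pos (show ((⟨x, hST x.2⟩ : T) : M) ∈ S from x.2)] at this
  exact this.symm

theorem IsPermLimit.flip (hM : IsPermLimit K M) :
    IsPermLimit {A | flipPerm A ∈ K} (flipPerm M) where
  countable := hM.countable
  nonempty := hM.nonempty
  isPermutation := hM.isPermutation.flip
  mem_of_emb P hP f hf hinj := by
    refine hM.mem_of_emb (flipPerm P) hP f ?_ hinj
    intro i x y
    fin_cases i
    · exact hf 0 x y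
    · exact hf 1 y x
  extend P hP s a h ha hs := by
    obtain ⟨m, hm⟩ := hM.extend (flipPerm P) hP s a h ha (by
      intro i x hx y hy
      fin_cases i
      · exact hs 0 x hx y hy
      · exact hs 1 y hy x hx)
    refine ⟨m, fun i x hx => ?_⟩
    fin_cases i
    · exact hm 0 x hx
    · exact ⟨(hm 1 x hx).2, (hm 1 x hx).1⟩

end

/-! ### The homogeneous permutations -/

/-- A point strictly between the images of the points of `s` on either side of `a`. -/
theorem exists_between_images {P : Type u} [permLang.Structure P] [Finite P] {α : Type v}
    [LinearOrder α] [DenselyOrdered α] [NoMinOrder α]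
    [NoMaxOrder α] [Nonempty α] (i : Fin 2) (s : Set P) (a : P) (k : P → α)
    (hk : ∀ x ∈ s, ∀ y ∈ s, permLt i x a → permLt i a y → k x < k y) :
    ∃ c : α, ∀ x ∈ s, (permLt i x a → k x < c) ∧ (permLt i a x → c < k x) := by
  classical
  obtain ⟨c, h1, h2⟩ := Order.exists_between_finsets
    ((Set.toFinite {x | x ∈ s ∧ permLt i x a}).toFinset.image k)
    ((Set.toFinite {x | x ∈ s ∧ permLt i a x}).toFinset.image k) (by
      intro x hx y hy
      simp only [Finset.mem_image, Set.Finite.mem_toFinset, Set.mem_ofPred_eq] at hx hy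
      obtain ⟨x, hx, rfl⟩ := hx
      obtain ⟨y, hy, rfl⟩ := hy
      exact hk x hx.1 y hy.1 hx.2 hy.2)
  refine ⟨c, fun x hx => ⟨fun h => h1 _ ?_, fun h => h2 _ ?_⟩⟩
  · exact Finset.mem_image_of_mem _ (by simpa using ⟨hx, h⟩)
  · exact Finset.mem_image_of_mem _ (by simpa using ⟨hx, h⟩)

theorem isPermLimit_trivialPerms :
    IsPermLimit trivialPerms.{w} (permOf (M := PUnit) (fun _ => 0) (fun _ => 0)) where
  countable := inferInstanceAs (Countable PUnit)
  nonempty := inferInstanceAs (Nonempty PUnit)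
  isPermutation := isPermutation_permOf
      (Function.injective_of_subsingleton _) (Function.injective_of_subsingleton _)
  mem_of_emb P hP f hf hinj :=
    ⟨⟨hP, hf.isPermutation hinj (isPermutation_permOf (Function.injective_of_subsingleton _)
      (Function.injective_of_subsingleton _))⟩,
      ⟨fun x y => hinj (Subsingleton.elim (α := PUnit) (f x) (f y))⟩⟩
  extend P hP s a h ha hs := by
    have := hP.2
    refine ⟨PUnit.unit, fun i x hx => absurd hx ?_⟩
    rwa [Subsingleton.elim x a]

theorem isPermLimit_identityPerms :
    IsPermLimit identityPerms.{w} (permOf (M := ULift.{w} ℚ) ULift.down ULift.down) where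
  countable := inferInstanceAs (Countable (ULift ℚ))
  nonempty := inferInstanceAs (Nonempty (ULift ℚ))
  isPermutation := isPermutation_permOf ULift.down_injective ULift.down_injective
  mem_of_emb P hP f hf hinj :=
    ⟨⟨hP, hf.isPermutation hinj (isPermutation_permOf ULift.down_injective ULift.down_injective)⟩,
      fun x y => (hf 1 x y).symm.trans (hf 0 x y)⟩
  extend P hP s a h ha hs := by
    have := hP.1.1
    obtain ⟨c, hc⟩ := exists_between_images 0 s a (fun x => (h x).down)
      (fun x hx y hy hxa hay => (hs 0 x hx y hy).2 (permLt_trans hP.1.2 hxa hay))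
    refine ⟨ULift.up c, fun i x hx => ?_⟩
    fin_cases i
    · exact hc x hx
    · exact ⟨fun h => (hc x hx).1 ((hP.2 _ _).1 h), fun h => (hc x hx).2 ((hP.2 _ _).1 h)⟩

/-- A new point either joins a block already met by `s`, where density of the second coordinate
gives it a place, or opens a block of its own, placed by density of the first coordinate. -/
theorem isPermLimit_incDecPerms : IsPermLimit incDecPerms.{w} (lexPerm ℚ ℚ) where
  countable := inferInstanceAs (Countable (ULift (ℚ × ℚ)))
  nonempty := inferInstanceAs (Nonempty (ULift (ℚ × ℚ)))
  isPermutation := isPermutation_lexPerm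
  mem_of_emb P hP f hf hinj := ⟨⟨hP, hf.isPermutation hinj isPermutation_lexPerm⟩,
    fun h => lexPerm_not_hasPattern_231 (h.of_isPermEmb hf),
    fun h => lexPerm_not_hasPattern_312 (h.of_isPermEmb hf)⟩
  extend P hP s a h ha hs := by
    obtain ⟨⟨hfin, hperm⟩, h231, h312⟩ := hP
    have h0 : ∀ x ∈ s, ∀ y ∈ s, permLt 0 x y → (h x).down.1 < (h y).down.1 ∨
        (h x).down.1 = (h y).down.1 ∧ (h x).down.2 < (h y).down.2 :=
      fun x hx y hy hxy => permLt_zero_lexPerm.1 ((hs 0 x hx y hy).2 hxy)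
    have h1 : ∀ x ∈ s, ∀ y ∈ s, permLt 1 x y → (h x).down.1 < (h y).down.1 ∨
        (h x).down.1 = (h y).down.1 ∧ (h y).down.2 < (h x).down.2 :=
      fun x hx y hy hxy => permLt_one_lexPerm.1 ((hs 1 x hx y hy).2 hxy)
    have hbelow : ∀ x ∈ s, ∀ y ∈ s, PermBelow x y → (h x).down.1 < (h y).down.1 := by
      intro x hx y hy hxy
      have h2 := h0 x hx y hy hxy.1
      have h3 := h1 x hx y hy hxy.2
      grind
    have hincomp : ∀ x ∈ s, ∀ y ∈ s, ¬ PermBelow x y → ¬ PermBelow y x →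
        (h x).down.1 = (h y).down.1 := by
      intro x hx y hy hxy hyx
      rcases descent_of_not_permBelow hperm hxy hyx with rfl | h2 | h2
      · rfl
      · have h3 := h0 x hx y hy h2.1
        have h4 := h1 y hy x hx h2.2
        grind
      · have h3 := h0 y hy x hx h2.1
        have h4 := h1 x hx y hy h2.2
        grind
    have hne : ∀ x ∈ s, x ≠ a := fun x hx hxa => ha (hxa ▸ hx)
    by_cases hz : ∃ z ∈ s, ¬ PermBelow z a ∧ ¬ PermBelow a z
    · obtain ⟨z, hzs, hza, haz⟩ := hz
      -- The block of `a` is that of `z`; `c` fits `a` among the points of `s` in this block.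
      -- Ordering by `<₀` suffices, because `<₁` is its reverse there.
      obtain ⟨c, hc⟩ := exists_between_images 0
        {x | x ∈ s ∧ ¬ PermBelow x a ∧ ¬ PermBelow a x} a (fun x => (h x).down.2) (by
          rintro x ⟨hx, hxa, hax⟩ y ⟨hy, hya, hay⟩ h2 h3
          have h4 := h0 x hx y hy (permLt_trans hperm h2 h3)
          have hxy : ¬ PermBelow x y := fun h5 =>
            hxa (permBelow_of_permBelow_left hperm h231 h312 hya hay h5)
          have hyx : ¬ PermBelow y x := fun h5 =>
            hya (permBelow_of_permBelow_left hperm h231 h312 hxa hax h5)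
          have h5 := hincomp x hx y hy hxy hyx
          grind)
      refine ⟨ULift.up ((h z).down.1, c), fun i x hx => ?_⟩
      by_cases hxa : PermBelow x a
      · have hxz := hbelow x hx z hzs
          (permBelow_of_permBelow_left hperm h231 h312 haz hza hxa)
        refine ⟨fun _ => ?_, fun h' => ?_⟩
        · fin_cases i
          · exact permLt_zero_lexPerm.2 (Or.inl hxz)
          · exact permLt_one_lexPerm.2 (Or.inl hxz)
        · fin_cases i
          · exact absurd h' (permLt_asymm hperm hxa.1)
          · exact absurd h' (permLt_asymm hperm hxa.2)
      by_cases hax : PermBelow a x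
      · have hzx := hbelow z hzs x hx
          (permBelow_of_permBelow_right hperm h231 h312 haz hza hax)
        refine ⟨fun h' => ?_, fun _ => ?_⟩
        · fin_cases i
          · exact absurd h' (permLt_asymm hperm hax.1)
          · exact absurd h' (permLt_asymm hperm hax.2)
        · fin_cases i
          · exact permLt_zero_lexPerm.2 (Or.inl hzx)
          · exact permLt_one_lexPerm.2 (Or.inl hzx)
      have hxz : (h x).down.1 = (h z).down.1 := hincomp x hx z hzs
        (fun h5 => hxa (permBelow_of_permBelow_left hperm h231 h312 hza haz h5))
        (fun h5 => hza (permBelow_of_permBelow_left hperm h231 h312 hxa hax h5))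
      have hcx := hc x ⟨hx, hxa, hax⟩
      rcases descent_of_not_permBelow hperm hxa hax with h2 | h2 | h2
      · exact absurd h2 (hne x hx)
      · fin_cases i
        · exact ⟨fun _ => permLt_zero_lexPerm.2 (Or.inr ⟨hxz, hcx.1 h2.1⟩),
            fun h' => absurd h' (permLt_asymm hperm h2.1)⟩
        · exact ⟨fun h' => absurd h' (permLt_asymm hperm h2.2),
            fun _ => permLt_one_lexPerm.2 (Or.inr ⟨hxz.symm, hcx.1 h2.1⟩)⟩
      · fin_cases i
        · exact ⟨fun h' => absurd h' (permLt_asymm hperm h2.1),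
            fun _ => permLt_zero_lexPerm.2 (Or.inr ⟨hxz.symm, hcx.2 h2.1⟩)⟩
        · exact ⟨fun _ => permLt_one_lexPerm.2 (Or.inr ⟨hxz, hcx.2 h2.1⟩),
            fun h' => absurd h' (permLt_asymm hperm h2.2)⟩
    · push Not at hz
      -- Here `a` is comparable to every point of `s`, so either order decides on which side of each
      -- point it lies.
      have hcomp : ∀ i, ∀ x ∈ s, (permLt i x a → PermBelow x a) ∧
          (permLt i a x → PermBelow a x) := by
        intro i x hx
        by_cases hxa : PermBelow x a
        · refine ⟨fun _ => hxa, fun h' => absurd h' ?_⟩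
          fin_cases i
          · exact permLt_asymm hperm hxa.1
          · exact permLt_asymm hperm hxa.2
        · have hax := hz x hx hxa
          refine ⟨fun h' => absurd h' ?_, fun _ => hax⟩
          fin_cases i
          · exact permLt_asymm hperm hax.1
          · exact permLt_asymm hperm hax.2
      obtain ⟨c, hc⟩ := exists_between_images 0 s a (fun x => (h x).down.1)
        (fun x hx y hy hxa hay => hbelow x hx y hy
          (PermBelow.trans hperm ((hcomp 0 x hx).1 hxa) ((hcomp 0 y hy).2 hay)))
      -- The second coordinate is arbitrary: no point of `s` is sent to block `c` if it is related
      -- to `a`.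
      refine ⟨ULift.up (c, 0), fun i x hx => ⟨fun h' => ?_, fun h' => ?_⟩⟩
      · have := (hc x hx).1 ((hcomp i x hx).1 h').1
        fin_cases i
        · exact permLt_zero_lexPerm.2 (Or.inl this)
        · exact permLt_one_lexPerm.2 (Or.inl this)
      · have := (hc x hx).2 ((hcomp i x hx).2 h').1
        fin_cases i
        · exact permLt_zero_lexPerm.2 (Or.inl this)
        · exact permLt_one_lexPerm.2 (Or.inl this)

/-- The elements of `ℚ(√2)`, ordered by their two real embeddings. -/
noncomputable def sqrtTwoPerm : Bundled.{w} permLang.Structure :=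
  permOf (M := ULift.{w} (ℚ × ℚ)) (fun z => (z.down.1 : ℝ) + z.down.2 * √2)
    (fun z => (z.down.1 : ℝ) - z.down.2 * √2)

/-- Different coefficients of `√2` would make it rational. Consequently no two points of
`sqrtTwoPerm` tie in either order. -/
theorem rat_add_mul_sqrt_two_injective {a b c d : ℚ} (h : (a : ℝ) + b * √2 = c + d * √2) :
    a = c ∧ b = d := by
  by_cases hbd : b = d
  · subst hbd
    exact ⟨by exact_mod_cast add_right_cancel h, rfl⟩
  · exfalso
    have hne : (b : ℝ) - d ≠ 0 := by
      intro h'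
      exact hbd (by exact_mod_cast sub_eq_zero.1 h')
    apply irrational_sqrt_two
    refine ⟨(c - a) / (b - d), ?_⟩
    push_cast
    rw [div_eq_iff hne]
    linarith

theorem isPermutation_sqrtTwoPerm : IsPermutation sqrtTwoPerm.{w} := by
  apply isPermutation_permOf
  · rintro ⟨x⟩ ⟨y⟩ h
    have := rat_add_mul_sqrt_two_injective h
    exact congrArg ULift.up (Prod.ext this.1 this.2)
  · rintro ⟨x⟩ ⟨y⟩ h
    have := rat_add_mul_sqrt_two_injective (a := x.1) (b := -x.2) (c := y.1) (d := -y.2) (by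
      push_cast
      dsimp only at h
      linarith)
    exact congrArg ULift.up (Prod.ext this.1 (neg_injective this.2))

/-- The two real embeddings of `ℚ(√2)` are jointly dense. -/
theorem exists_rat_sqrt_two_mem_box {s₀ s₁ t₀ t₁ : ℝ} (hs : s₀ < s₁) (ht : t₀ < t₁) :
    ∃ a b : ℚ, s₀ < a + b * √2 ∧ a + b * √2 < s₁ ∧ t₀ < a - b * √2 ∧ a - b * √2 < t₁ := by
  have h2 : (0 : ℝ) < 2 * √2 := by positivity
  -- The two conjugates differ by `2 * b * √2`, so `b` is chosen to make this a possible difference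
  -- between coordinates in the box; then the two intervals allowed for `a` overlap.
  obtain ⟨b, hb1, hb2⟩ := exists_rat_btwn (show (s₀ - t₁) / (2 * √2) < (s₁ - t₀) / (2 * √2) by
    gcongr)
  rw [div_lt_iff₀ h2] at hb1
  rw [lt_div_iff₀ h2] at hb2
  obtain ⟨a, ha1, ha2⟩ := exists_rat_btwn
    (show max (s₀ - b * √2) (t₀ + b * √2) < min (s₁ - b * √2) (t₁ + b * √2) by
      rw [max_lt_iff, lt_min_iff, lt_min_iff]
      refine ⟨⟨?_, ?_⟩, ?_, ?_⟩ <;> linarith)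
  rw [max_lt_iff] at ha1
  rw [lt_min_iff] at ha2
  exact ⟨a, b, by linarith, by linarith, by linarith, by linarith⟩

theorem isPermLimit_allPerms : IsPermLimit allPerms.{w} sqrtTwoPerm where
  countable := inferInstanceAs (Countable (ULift (ℚ × ℚ)))
  nonempty := inferInstanceAs (Nonempty (ULift (ℚ × ℚ)))
  isPermutation := isPermutation_sqrtTwoPerm
  mem_of_emb P hP f hf hinj := ⟨hP, hf.isPermutation hinj isPermutation_sqrtTwoPerm⟩
  extend P hP s a h ha hs := by
    have := hP.1
    -- A single real cut is not enough: density in a box requires an open interval of admissible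
    -- values in each order.
    have key : ∀ (i : Fin 2) (k : P → ℝ),
        (∀ x ∈ s, ∀ y ∈ s, permLt i x a → permLt i a y → k x < k y) →
        ∃ c d : ℝ, c < d ∧ ∀ x ∈ s, (permLt i x a → k x < c) ∧ (permLt i a x → d < k x) := by
      intro i k hk
      obtain ⟨c, hc⟩ := exists_between_images i s a k hk
      -- Replacing the values on the lower side by `c` forces the second cut `d` strictly above `c`,
      -- provided there is a lower point.
      obtain ⟨d, hd⟩ := exists_between_images i s a
        (fun x => open Classical in if permLt i x a then c else k x) (by
          intro x hx y hy h1 h2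
          rw [if_pos h1, if_neg (permLt_asymm hP.2 h2)]
          exact (hc y hy).2 h2)
      by_cases hex : ∃ x ∈ s, permLt i x a
      · obtain ⟨x, hx, hxa⟩ := hex
        have hcd := (hd x hx).1 hxa
        rw [if_pos hxa] at hcd
        refine ⟨c, d, hcd, fun y hy => ⟨(hc y hy).1, fun h1 => ?_⟩⟩
        have := (hd y hy).2 h1
        rwa [if_neg (permLt_asymm hP.2 h1)] at this
      · refine ⟨c - 1, c, by linarith, fun y hy => ⟨fun h1 => absurd ⟨y, hy, h1⟩ hex, (hc y hy).2⟩⟩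
    obtain ⟨s₀, s₁, hs₀, hs₁⟩ := key 0 (fun x => ((h x).down.1 : ℝ) + (h x).down.2 * √2)
      (fun x hx y hy hxa hay => (hs 0 x hx y hy).2 (permLt_trans hP.2 hxa hay))
    obtain ⟨t₀, t₁, ht₀, ht₁⟩ := key 1 (fun x => ((h x).down.1 : ℝ) - (h x).down.2 * √2)
      (fun x hx y hy hxa hay => (hs 1 x hx y hy).2 (permLt_trans hP.2 hxa hay))
    obtain ⟨p, q, h1, h2, h3, h4⟩ := exists_rat_sqrt_two_mem_box hs₀ ht₀
    refine ⟨ULift.up (p, q), fun i x hx => ?_⟩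
    fin_cases i
    · exact ⟨fun hxa => ((hs₁ x hx).1 hxa).trans h1, fun hxa => h2.trans ((hs₁ x hx).2 hxa)⟩
    · exact ⟨fun hxa => ((ht₁ x hx).1 hxa).trans h3, fun hxa => h4.trans ((ht₁ x hx).2 hxa)⟩

/-! ### Amalgamation -/

/-- The closure properties of a class of permutations used in the classification. -/
structure IsAmalgamationClass (K : Set (Bundled.{w} permLang.Structure)) : Prop where
  subset_allPerms : K ⊆ allPerms
  exists_nonempty : ∃ A ∈ K, Nonempty A
  mem_of_emb : ∀ (A B : Bundled.{w} permLang.Structure) (f : A → B), A ∈ allPerms → IsPermEmb f →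
    B ∈ K → A ∈ K
  amalgamation : ∀ (A B C : Bundled.{w} permLang.Structure) (f : A → B) (g : A → C), A ∈ K →
    B ∈ K → C ∈ K → IsPermEmb f → IsPermEmb g →
    ∃ D ∈ K, ∃ (f' : B → D) (g' : C → D), IsPermEmb f' ∧ IsPermEmb g' ∧ f' ∘ f = g' ∘ g

theorem FirstOrder.Language.Hereditary.mem_of_isPermEmb {K : Set (Bundled.{w} permLang.Structure)}
    (h : FirstOrder.Language.Hereditary K) (A B : Bundled.{w} permLang.Structure) (f : A → B)
    (hA : A ∈ allPerms) (hf : IsPermEmb f) (hB : B ∈ K) : A ∈ K :=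
  h B hB ⟨Language.Structure.fg_iff_finite.2 hA.1, ⟨hf.toEmb (hf.injective hA.2)⟩⟩

theorem IsPermutationClass.isAmalgamationClass {K : Set (Bundled.{w} permLang.Structure)}
    (hK : IsPermutationClass K) (h : Language.Amalgamation K) : IsAmalgamationClass K where
  subset_allPerms := hK.subset_allPerms
  exists_nonempty := hK.exists_nonempty
  mem_of_emb := hK.hereditary.mem_of_isPermEmb
  amalgamation A B C f g hA hB hC hf hg := by
    have hinj := (hK.subset_allPerms hA).2
    obtain ⟨D, f', g', hD, hfg⟩ := h A B C (hf.toEmb (hf.injective hinj))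
      (hg.toEmb (hg.injective hinj)) hA hB hC
    exact ⟨D, hD, f', g', isPermEmb_of_emb f', isPermEmb_of_emb g',
      funext fun x => DFunLike.congr_fun hfg x⟩

/-- A Ramsey class with the joint embedding property has amalgamation: colour the copies of `A`
according to whether they extend to a copy of `B`. -/
theorem IsPermutationClass.isAmalgamationClass_of_isRamseyClass
    {K : Set (Bundled.{w} permLang.Structure)} (hK : IsPermutationClass K)
    (h : IsRamseyClass K) : IsAmalgamationClass K where
  subset_allPerms := hK.subset_allPerms
  exists_nonempty := hK.exists_nonempty
  mem_of_emb := hK.hereditary.mem_of_isPermEmb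
  amalgamation A B C f g hA hB hC hf hg := by
    classical
    obtain ⟨E, hE, ⟨β⟩, ⟨γ⟩⟩ := hK.jointEmbedding B hB C hC
    have hβ := isPermEmb_of_emb β
    have hγ := isPermEmb_of_emb γ
    obtain ⟨D, hD, hχ⟩ := h.hasRamseyProperty hK.subset_allPerms A hA E hE 1
    -- The copy of `A` through `β ∘ f` visibly extends to `B`, so the constant colour is 1 and the
    -- copy through `γ ∘ g` extends as well.
    obtain ⟨i, e, he, hi⟩ := hχ (fun α => if ∃ b : B → D, IsPermEmb b ∧ b ∘ f = α then 1 else 0)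
    have h1 := hi (β ∘ f) (hβ.comp hf)
    rw [if_pos ⟨e ∘ β, he.comp hβ, rfl⟩] at h1
    have h2 := hi (γ ∘ g) (hγ.comp hg)
    rw [← h1] at h2
    have h3 : ∃ b : B → D, IsPermEmb b ∧ b ∘ f = e ∘ γ ∘ g := by
      by_contra hn
      rw [if_neg hn] at h2
      exact absurd h2 (by decide)
    obtain ⟨b, hb, hbf⟩ := h3
    exact ⟨D, hD, b, e ∘ γ, hb, he.comp hγ, hbf⟩

/-! ### Amalgamating over the complement of two points -/

section

variable {K : Set (Bundled.{w} permLang.Structure)}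

theorem restr_mem_allPerms {P : Bundled.{w} permLang.Structure} (hP : P ∈ allPerms) (s : Set P) :
    restr P s ∈ allPerms :=
  have := hP.1
  ⟨inferInstanceAs (Finite s), (isPermEmb_restr P s).isPermutation Subtype.val_injective hP.2⟩

/-- Amalgamating `P \ {x}` and `P \ {y}` produces all relations of `P` but those between `x`
and `y`. -/
theorem IsAmalgamationClass.exists_amalgam (hK : IsAmalgamationClass K)
    {P : Bundled.{w} permLang.Structure} (hP : P ∈ allPerms) {x y : P} (hxy : x ≠ y)
    (hx : restr P {x}ᶜ ∈ K) (hy : restr P {y}ᶜ ∈ K) :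
    ∃ D ∈ K, ∃ h : P → D, ∀ i u v, ¬ (u = x ∧ v = y) → ¬ (u = y ∧ v = x) →
      (permLt i (h u) (h v) ↔ permLt i u v) := by
  classical
  let f : restr P ({x}ᶜ ∩ {y}ᶜ) → restr P {x}ᶜ := fun z => ⟨z.1, z.2.1⟩
  let g : restr P ({x}ᶜ ∩ {y}ᶜ) → restr P {y}ᶜ := fun z => ⟨z.1, z.2.2⟩
  have hf : IsPermEmb f := fun _ _ _ => Iff.rfl
  have hg : IsPermEmb g := fun _ _ _ => Iff.rfl
  obtain ⟨D, hD, f', g', hf', hg', hfg⟩ := hK.amalgamation _ _ _ f g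
    (hK.mem_of_emb _ _ f (restr_mem_allPerms hP _) hf hx) hx hy hf hg
  have hfg' : ∀ z (hzx : z ≠ x) (hzy : z ≠ y), f' ⟨z, hzx⟩ = g' ⟨z, hzy⟩ :=
    fun z hzx hzy => congrFun hfg ⟨z, hzx, hzy⟩
  -- `g'` sees `x` and `f'` sees `y`, and they agree elsewhere. No single factor sees both, so `D`
  -- may even identify them.
  let h : P → D := fun z => if hz : z = x then g' ⟨x, hxy⟩ else f' ⟨z, hz⟩
  have h1 : ∀ z (hz : z ≠ x), h z = f' ⟨z, hz⟩ := fun z hz => dif_neg hz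
  have h2 : ∀ z (hz : z ≠ y), h z = g' ⟨z, hz⟩ := fun z hz => by
    by_cases hzx : z = x
    · subst hzx
      exact dif_pos rfl
    · rw [h1 z hzx, hfg' z hzx hz]
  refine ⟨D, hD, h, fun i u v huv hvu => ?_⟩
  by_cases hux : u = x
  · have huy : u ≠ y := hux ▸ hxy
    have hvy : v ≠ y := fun hv => huv ⟨hux, hv⟩
    rw [h2 u huy, h2 v hvy]
    exact hg' i _ _
  · by_cases hvx : v = x
    · have huy : u ≠ y := fun hu => hvu ⟨hu, hvx⟩
      rw [h2 u huy, h2 v (hvx ▸ hxy)]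
      exact hg' i _ _
    · rw [h1 u hux, h1 v hvx]
      exact hf' i _ _

/-- `x` and `y` are separated in the order `<ᵢ` by a third point. -/
def PermSeparated {P : Type u} [permLang.Structure P] (i : Fin 2) (x y : P) : Prop :=
  ∃ z, (permLt i x z ∧ permLt i z y) ∨ (permLt i y z ∧ permLt i z x)

theorem PermSeparated.symm {P : Type u} [permLang.Structure P] {i : Fin 2} {x y : P}
    (h : PermSeparated i x y) : PermSeparated i y x := by
  obtain ⟨z, hz⟩ := h
  exact ⟨z, hz.symm⟩

/-- A relation between `x` and `y` that is witnessed by a third point survives amalgamation. -/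
theorem PermSeparated.permLt_iff {P : Bundled.{w} permLang.Structure} (hP : IsPermutation P)
    {D : Bundled.{w} permLang.Structure} (hD : IsPermutation D) {h : P → D} {i : Fin 2} {x y : P}
    (hh : ∀ u v, ¬ (u = x ∧ v = y) → ¬ (u = y ∧ v = x) →
      (permLt i (h u) (h v) ↔ permLt i u v)) (hs : PermSeparated i x y) :
    permLt i (h x) (h y) ↔ permLt i x y := by
  have hne : ∀ u v : P, permLt i u v → u ≠ v := fun u v huv h => by
    subst h
    exact permLt_irrefl hP i _ huv
  obtain ⟨z, ⟨h1, h2⟩ | ⟨h1, h2⟩⟩ := hs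
  · refine iff_of_true (permLt_trans hD ((hh x z ?_ ?_).2 h1) ((hh z y ?_ ?_).2 h2))
      (permLt_trans hP h1 h2)
    · exact fun h => hne _ _ h2 h.2
    · exact fun h => hne _ _ h1 h.2.symm
    · exact fun h => hne _ _ h1 h.1.symm
    · exact fun h => hne _ _ h2 h.1
  · refine iff_of_false (permLt_asymm hD (permLt_trans hD ((hh y z ?_ ?_).2 h1)
      ((hh z x ?_ ?_).2 h2))) (permLt_asymm hP (permLt_trans hP h1 h2))
    · exact fun h => hne _ _ h1 h.2.symm
    · exact fun h => hne _ _ h2 h.2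
    · exact fun h => hne _ _ h2 h.1
    · exact fun h => hne _ _ h1 h.1.symm

/-- Only the pair `x`, `y` is left open by the amalgam, and transitivity through the separating
points settles it in each order. -/
theorem isPermEmb_of_permSeparated {P : Bundled.{w} permLang.Structure} (hP : IsPermutation P)
    {D : Bundled.{w} permLang.Structure} (hD : IsPermutation D) {h : P → D} {x y : P}
    (hh : ∀ i u v, ¬ (u = x ∧ v = y) → ¬ (u = y ∧ v = x) →
      (permLt i (h u) (h v) ↔ permLt i u v)) (hs : ∀ i, PermSeparated i x y) : IsPermEmb h := by
  intro i u v
  by_cases h1 : u = x ∧ v = y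
  · obtain ⟨rfl, rfl⟩ := h1
    exact (hs i).permLt_iff hP hD (hh i)
  · by_cases h2 : u = y ∧ v = x
    · obtain ⟨rfl, rfl⟩ := h2
      exact (hs i).symm.permLt_iff hP hD (fun u v h3 h4 => hh i u v h4 h3)
    · exact hh i u v h1 h2

/-- If two points are separated in both orders then the amalgam is forced. -/
theorem IsAmalgamationClass.mem_of_permSeparated (hK : IsAmalgamationClass K)
    {P : Bundled.{w} permLang.Structure} (hP : P ∈ allPerms) {x y : P} (hxy : x ≠ y)
    (hx : restr P {x}ᶜ ∈ K) (hy : restr P {y}ᶜ ∈ K) (hs : ∀ i, PermSeparated i x y) : P ∈ K := by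
  obtain ⟨D, hD, h, hh⟩ := hK.exists_amalgam hP hxy hx hy
  exact hK.mem_of_emb P D h hP
    (isPermEmb_of_permSeparated hP.2 (hK.subset_allPerms hD).2 hh hs) hD

/-! ### Patterns as permutations -/

/-- The finite permutation with pattern `p`. -/
def patPerm {n : ℕ} (p : Fin n → ℕ) : Bundled.{w} permLang.Structure :=
  permOf (M := ULift.{w} (Fin n)) (fun x => p x.down) ULift.down

theorem patPerm_mem_allPerms {n : ℕ} {p : Fin n → ℕ} (hp : Function.Injective p) :
    patPerm.{w} p ∈ allPerms :=
  ⟨inferInstanceAs (Finite (ULift (Fin n))),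
    isPermutation_permOf (hp.comp ULift.down_injective) ULift.down_injective⟩

theorem hasPattern_iff_exists_emb {M : Type u} [permLang.Structure M] {n : ℕ} {p : Fin n → ℕ} :
    HasPattern M p ↔ ∃ f : patPerm.{w} p → M, IsPermEmb f := by
  constructor
  · rintro ⟨x, hx⟩
    refine ⟨fun z => x z.down, fun i y z => ?_⟩
    fin_cases i
    · exact (hx y.down z.down).1
    · exact (hx y.down z.down).2
  · rintro ⟨f, hf⟩
    exact ⟨fun i => f (ULift.up i), fun i j => ⟨hf 0 _ _, hf 1 _ _⟩⟩

theorem IsAmalgamationClass.patPerm_mem (hK : IsAmalgamationClass K) {n : ℕ} {p : Fin n → ℕ}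
    (hp : Function.Injective p) {P : Bundled.{w} permLang.Structure} (hP : P ∈ K)
    (h : HasPattern P p) : patPerm p ∈ K := by
  obtain ⟨f, hf⟩ := hasPattern_iff_exists_emb.{w, w}.1 h
  exact hK.mem_of_emb _ P f (patPerm_mem_allPerms hp) hf hP

theorem IsAmalgamationClass.patPerm_mem_of_patPerm_mem (hK : IsAmalgamationClass K) {m n : ℕ}
    {q : Fin m → ℕ} {p : Fin n → ℕ} (hq : patPerm q ∈ K) (hp : Function.Injective p)
    (e : Fin n → Fin m) (he : ∀ i j, (q (e i) < q (e j) ↔ p i < p j) ∧ (e i < e j ↔ i < j)) :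
    patPerm p ∈ K :=
  hK.patPerm_mem hp hq ⟨fun i => ULift.up (e i), he⟩

/-- A permutation with as many points as its pattern is determined by the pattern. -/
theorem IsAmalgamationClass.mem_of_hasPattern (hK : IsAmalgamationClass K) {n : ℕ}
    {p : Fin n → ℕ} (hp : Function.Injective p) {P : Bundled.{w} permLang.Structure}
    (hP : P ∈ allPerms) (hn : Nat.card P ≤ n) (h : HasPattern P p) (hpK : patPerm p ∈ K) :
    P ∈ K := by
  obtain ⟨f, hf⟩ := hasPattern_iff_exists_emb.{w, w}.1 h
  have hinj := hf.injective (patPerm_mem_allPerms hp).2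
  have := hP.1
  have hfin : Finite (patPerm.{w} p) := (patPerm_mem_allPerms hp).1
  have hcard : Nat.card (patPerm.{w} p) = n := by
    change Nat.card (ULift (Fin n)) = n
    simp
  have hbij : Function.Bijective f := by
    refine (Nat.bijective_iff_injective_and_card f).2 ⟨hinj, ?_⟩
    have := Nat.card_le_card_of_injective f hinj
    omega
  let g := Equiv.ofBijective f hbij
  refine hK.mem_of_emb P _ g.symm hP (fun i x y => ?_) hpK
  have := hf i (g.symm x) (g.symm y)
  rw [show f (g.symm x) = x from g.apply_symm_apply x,
    show f (g.symm y) = y from g.apply_symm_apply y] at this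
  exact this.symm

/-- Deleting one point of a pattern. -/
theorem IsAmalgamationClass.restr_patPerm_mem (hK : IsAmalgamationClass K) {n : ℕ}
    {p : Fin (n + 1) → ℕ} (hp : Function.Injective p) {q : Fin n → ℕ} (a : Fin (n + 1))
    (hq : ∀ i j, q i < q j ↔ p (a.succAbove i) < p (a.succAbove j)) (hqK : patPerm q ∈ K) :
    restr (patPerm p) {ULift.up a}ᶜ ∈ K := by
  have hmem := restr_mem_allPerms (patPerm_mem_allPerms.{w} hp) {ULift.up a}ᶜ
  have hqi : Function.Injective q := fun i j hij => by
    have h1 := hq i j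
    have h2 := hq j i
    exact a.succAbove_right_injective (hp (by omega))
  refine hK.mem_of_hasPattern hqi hmem ?_
    ⟨fun i => ⟨ULift.up (a.succAbove i), fun h => a.succAbove_ne i (congrArg ULift.down h)⟩,
      fun i j => ⟨(hq i j).symm, a.succAbove_lt_succAbove_iff⟩⟩ hqK
  have hfin : Finite (patPerm.{w} p) := (patPerm_mem_allPerms hp).1
  change Nat.card ((({ULift.up a} : Set (ULift.{w} (Fin (n + 1))))ᶜ : Set _)) ≤ n
  have h1 := Set.ncard_add_ncard_compl ({ULift.up a} : Set (ULift.{w} (Fin (n + 1))))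
  rw [Set.ncard_singleton] at h1
  rw [Nat.card_coe_set_eq]
  simp at h1
  omega

/-- Two patterns obtained by deleting points `a` and `b` that are separated both horizontally and
vertically force the whole pattern. -/
theorem IsAmalgamationClass.patPerm_mem_of_separated (hK : IsAmalgamationClass K) {n : ℕ}
    {p : Fin (n + 1) → ℕ} (hp : Function.Injective p) {q r : Fin n → ℕ} (a b c d : Fin (n + 1))
    (hq : ∀ i j, q i < q j ↔ p (a.succAbove i) < p (a.succAbove j))
    (hr : ∀ i j, r i < r j ↔ p (b.succAbove i) < p (b.succAbove j))
    (hc : a < c ∧ c < b) (hd : (p a < p d ∧ p d < p b) ∨ (p b < p d ∧ p d < p a))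
    (hqK : patPerm q ∈ K) (hrK : patPerm r ∈ K) : patPerm p ∈ K := by
  refine hK.mem_of_permSeparated (patPerm_mem_allPerms hp) (x := ULift.up a) (y := ULift.up b)
    (fun h => ?_) (hK.restr_patPerm_mem hp a hq hqK) (hK.restr_patPerm_mem hp b hr hrK) ?_
  · have := congrArg ULift.down h
    exact (hc.1.trans hc.2).ne this
  · intro i
    fin_cases i
    · exact ⟨ULift.up d, hd⟩
    · exact ⟨ULift.up c, Or.inl hc⟩

end

/-! ### Minimal obstructions and the classification -/

/-- The patterns that can be minimal among those missing from an amalgamation class. -/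
inductive IsMinimalPattern : ∀ {n : ℕ}, (Fin n → ℕ) → Prop
  | p12 : IsMinimalPattern ![1, 2]
  | p21 : IsMinimalPattern ![2, 1]
  | p132 : IsMinimalPattern ![1, 3, 2]
  | p213 : IsMinimalPattern ![2, 1, 3]
  | p231 : IsMinimalPattern ![2, 3, 1]
  | p312 : IsMinimalPattern ![3, 1, 2]
  | p2413 : IsMinimalPattern ![2, 4, 1, 3]
  | p3142 : IsMinimalPattern ![3, 1, 4, 2]

theorem IsMinimalPattern.injective {n : ℕ} {p : Fin n → ℕ} (hp : IsMinimalPattern p) :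
    Function.Injective p := by
  cases hp <;> decide

theorem exists_equiv_fin {P : Type u} [permLang.Structure P] [Finite P] (hP : IsPermutation P)
    {n : ℕ} (hn : Nat.card P = n) :
    ∃ e : Fin n ≃ P, ∀ i j, permLt 1 (e i) (e j) ↔ i < j := by
  subst hn
  let f : P → Fin (Nat.card P) := fun x => ⟨permRank 1 x, by
    rw [← Set.ncard_univ]
    exact Set.ncard_lt_ncard ⟨Set.subset_univ _, fun h =>
      permLt_irrefl hP 1 x (h (Set.mem_univ x))⟩ (Set.toFinite _)⟩
  have hf : ∀ x y, f x < f y ↔ permLt 1 x y := permRank_lt_iff hP 1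
  have hinj : Function.Injective f := fun x y hxy => by
    rcases permLt_trichotomy hP 1 x y with h | h | h
    · exact absurd hxy ((hf x y).2 h).ne
    · exact h
    · exact absurd hxy ((hf y x).2 h).ne'
  let g := Equiv.ofBijective f ((Nat.bijective_iff_injective_and_card f).2 ⟨hinj, by simp⟩)
  refine ⟨g.symm, fun i j => ?_⟩
  rw [← hf]
  change g (g.symm i) < g (g.symm j) ↔ _
  rw [g.apply_symm_apply, g.apply_symm_apply]

section

variable {K : Set (Bundled.{w} permLang.Structure)}

theorem IsAmalgamationClass.mem_of_subsingleton (hK : IsAmalgamationClass K)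
    {P : Bundled.{w} permLang.Structure} (hP : P ∈ allPerms) [Subsingleton P] : P ∈ K := by
  obtain ⟨A, hA, ⟨a⟩⟩ := hK.exists_nonempty
  refine hK.mem_of_emb P A (fun _ => a) hP (fun i x y => ?_) hA
  rw [Subsingleton.elim y x]
  exact iff_of_false (permLt_irrefl (hK.subset_allPerms hA).2 i a) (permLt_irrefl hP.2 i x)

/-- Every permutation missing from an amalgamation class has one of eight patterns missing from
the class. -/
theorem IsAmalgamationClass.exists_minimalPattern (hK : IsAmalgamationClass K)
    (P : Bundled.{w} permLang.Structure) (hP : P ∈ allPerms) (hPK : P ∉ K) :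
    ∃ (n : ℕ) (p : Fin n → ℕ), IsMinimalPattern p ∧ HasPattern P p ∧ patPerm p ∉ K := by
  induction hn : Nat.card P using Nat.strong_induction_on generalizing P with
  | _ n ih =>
  have := hP.1
  -- Pass to a smaller missing permutation while possible; otherwise all one-point deletions are in
  -- `K`, and no two points are separated in both orders.
  by_cases hdel : ∃ x : P, restr P {x}ᶜ ∉ K
  · obtain ⟨x, hx⟩ := hdel
    have hlt : Nat.card (restr P {x}ᶜ) < n := by
      rw [← hn, ← Set.ncard_univ P]
      exact Set.ncard_lt_ncard (s := ({x}ᶜ : Set P)) ⟨Set.subset_univ _, fun h =>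
        h (Set.mem_univ x) rfl⟩ (Set.toFinite _)
    obtain ⟨m, p, h1, h2, h3⟩ := ih _ hlt _ (restr_mem_allPerms hP _) hx rfl
    exact ⟨m, p, h1, h2.of_isPermEmb (isPermEmb_restr P _), h3⟩
  push Not at hdel
  have hsep : ∀ x y : P, x ≠ y → ¬ (PermSeparated 0 x y ∧ PermSeparated 1 x y) :=
    fun x y hxy hs => hPK (hK.mem_of_permSeparated hP hxy (hdel x) (hdel y) (fun i => by
      fin_cases i
      · exact hs.1
      · exact hs.2))
  obtain ⟨e, he⟩ := exists_equiv_fin hP.2 hn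
  have hcard : Nat.card P ≤ n := hn.le
  let q : Fin n → ℕ := fun i => permRank 0 (e i)
  have hq : ∀ i j, q i < q j ↔ permLt 0 (e i) (e j) := fun i j => permRank_lt_iff hP.2 0 _ _
  have hqi : ∀ i j, i ≠ j → q i ≠ q j := fun i j hij h => by
    rcases permLt_trichotomy hP.2 0 (e i) (e j) with h' | h' | h'
    · exact absurd h ((hq i j).2 h').ne
    · exact hij (e.injective h')
    · exact absurd h ((hq j i).2 h').ne'
  have hno : ∀ i j k l : Fin n, i < k → k < j →
      ¬ ((q i < q l ∧ q l < q j) ∨ (q j < q l ∧ q l < q i)) := by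
    intro i j k l hik hkj hl
    refine hsep (e i) (e j) (fun h => (hik.trans hkj).ne (e.injective h)) ⟨⟨e l, ?_⟩, e k, ?_⟩
    · rwa [← hq, ← hq, ← hq, ← hq]
    · exact Or.inl ⟨(he i k).2 hik, (he k j).2 hkj⟩
  have finish : ∀ p : Fin n → ℕ, IsMinimalPattern p → (∀ i j, q i < q j ↔ p i < p j) →
      ∃ (n : ℕ) (p : Fin n → ℕ), IsMinimalPattern p ∧ HasPattern P p ∧ patPerm p ∉ K := by
    intro p hp hqp
    have hpat : HasPattern P p := ⟨e, fun i j => ⟨(hq i j).symm.trans (hqp i j), he i j⟩⟩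
    exact ⟨n, p, hp, hpat, fun h => hPK (hK.mem_of_hasPattern hp.injective hP hcard hpat h)⟩
  clear_value q
  match n, e, q, hqi, hno, finish with
  | 0, e, _, _, _, _ =>
    have : Subsingleton P := e.symm.subsingleton
    exact absurd (hK.mem_of_subsingleton hP) hPK
  | 1, e, _, _, _, _ =>
    have : Subsingleton P := e.symm.subsingleton
    exact absurd (hK.mem_of_subsingleton hP) hPK
  | 2, _, q, hqi, _, finish =>
    have h1 := hqi 0 1 (by decide)
    rcases lt_or_gt_of_ne h1 with h | h
    · exact finish _ .p12 (by simp [Fin.forall_fin_two]; omega)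
    · exact finish _ .p21 (by simp [Fin.forall_fin_two]; omega)
  | 3, _, q, hqi, hno, finish =>
    have h1 := hqi 0 1 (by decide)
    have h2 := hqi 0 2 (by decide)
    have h3 := hqi 1 2 (by decide)
    -- The outer points are separated in `<₁` by the middle one, so the middle one must be extreme
    -- in `<₀`.
    have h4 := hno 0 2 1 1 (by decide) (by decide)
    rcases lt_or_gt_of_ne h1 with h | h <;> rcases lt_or_gt_of_ne h2 with h' | h'
    · exact finish _ .p132 (by simp [Fin.forall_fin_succ]; omega)
    · exact finish _ .p231 (by simp [Fin.forall_fin_succ]; omega)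
    · exact finish _ .p213 (by simp [Fin.forall_fin_succ]; omega)
    · exact finish _ .p312 (by simp [Fin.forall_fin_succ]; omega)
  | 4, _, q, hqi, hno, finish =>
    have h1 := hqi 0 1 (by decide)
    have h2 := hqi 0 2 (by decide)
    have h3 := hqi 0 3 (by decide)
    have h4 := hqi 1 2 (by decide)
    have h5 := hqi 1 3 (by decide)
    have h6 := hqi 2 3 (by decide)
    -- The pairs at positions 0 and 2, 0 and 3, 1 and 3 must be adjacent in value, so the values run
    -- through positions 2, 0, 3, 1 in this order or its reverse.
    have h7 := hno 0 2 1 1 (by decide) (by decide)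
    have h8 := hno 0 2 1 3 (by decide) (by decide)
    have h9 := hno 0 3 1 1 (by decide) (by decide)
    have h10 := hno 0 3 1 2 (by decide) (by decide)
    have h11 := hno 1 3 2 0 (by decide) (by decide)
    have h12 := hno 1 3 2 2 (by decide) (by decide)
    rcases lt_or_gt_of_ne h2 with h | h
    · exact finish _ .p3142 (by simp [Fin.forall_fin_succ]; omega)
    · exact finish _ .p2413 (by simp [Fin.forall_fin_succ]; omega)
  | n + 5, _, q, hqi, hno, _ =>
    -- Positions 0, 2, 4 are pairwise separated in `<₁`, and whichever has the middle value
    -- separates the other two in `<₀`.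
    exfalso
    have a (i j : ℕ) (hi : i < n + 5) (hj : j < n + 5) (hij : i < j) :
        (⟨i, hi⟩ : Fin (n + 5)) < ⟨j, hj⟩ := hij
    have h1 := hqi _ _ (a 0 2 (by omega) (by omega) (by omega)).ne
    have h2 := hqi _ _ (a 0 4 (by omega) (by omega) (by omega)).ne
    have h3 := hqi _ _ (a 2 4 (by omega) (by omega) (by omega)).ne
    have h4 := hno _ _ _ ⟨4, by omega⟩ (a 0 1 (by omega) (by omega) (by omega))
      (a 1 2 (by omega) (by omega) (by omega))
    have h5 := hno _ _ _ ⟨2, by omega⟩ (a 0 1 (by omega) (by omega) (by omega))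
      (a 1 4 (by omega) (by omega) (by omega))
    have h6 := hno _ _ _ ⟨0, by omega⟩ (a 2 3 (by omega) (by omega) (by omega))
      (a 3 4 (by omega) (by omega) (by omega))
    omega

/-! ### Three-point patterns -/

theorem IsAmalgamationClass.exists_amalgam_patPerm (hK : IsAmalgamationClass K) {n : ℕ}
    {p : Fin (n + 1) → ℕ} (hp : Function.Injective p) {q r : Fin n → ℕ} {a b : Fin (n + 1)}
    (hab : a ≠ b) (hq : ∀ i j, q i < q j ↔ p (a.succAbove i) < p (a.succAbove j))
    (hr : ∀ i j, r i < r j ↔ p (b.succAbove i) < p (b.succAbove j))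
    (hqK : patPerm q ∈ K) (hrK : patPerm r ∈ K) :
    ∃ D ∈ K, ∃ h : Fin (n + 1) → D, ∀ i j, ¬ (i = a ∧ j = b) → ¬ (i = b ∧ j = a) →
      (p i < p j → permLt 0 (h i) (h j)) ∧ (i < j → permLt 1 (h i) (h j)) := by
  obtain ⟨D, hD, h, hh⟩ := hK.exists_amalgam (patPerm_mem_allPerms hp) (x := ULift.up a)
    (y := ULift.up b) (fun h => hab (congrArg ULift.down h)) (hK.restr_patPerm_mem hp a hq hqK)
    (hK.restr_patPerm_mem hp b hr hrK)
  refine ⟨D, hD, fun i => h (ULift.up i), fun i j h1 h2 => ?_⟩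
  have h3 := fun k => hh k (ULift.up i) (ULift.up j)
    (fun h => h1 ⟨congrArg ULift.down h.1, congrArg ULift.down h.2⟩)
    (fun h => h2 ⟨congrArg ULift.down h.1, congrArg ULift.down h.2⟩)
  exact ⟨(h3 0).2, (h3 1).2⟩

/-- A member of `K` with three prescribed points contributes its pattern. -/
theorem IsAmalgamationClass.patPerm_mem_of_three (hK : IsAmalgamationClass K)
    {D : Bundled.{w} permLang.Structure} (hD : D ∈ K) (x y z : D) {p : Fin 3 → ℕ}
    (hp : Function.Injective p) (h01 : permLt 1 x y) (h12 : permLt 1 y z)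
    (h : ∀ i j, p i < p j → permLt 0 (![x, y, z] i) (![x, y, z] j)) : patPerm p ∈ K :=
  hK.patPerm_mem hp hD (hasPattern_three (hK.subset_allPerms hD).2 ![x, y, z] p h01 h12 h hp)

/-- A descent and an ascent are amalgamated over a point that is middle in `<₁` and lowest in `<₀`;
only the `<₀`-order of the two outer points is open. The next three lemmas put the common point at
the top, the left and the right instead. -/
theorem IsAmalgamationClass.p213_or_p312 (hK : IsAmalgamationClass K)
    (h12 : patPerm ![1, 2] ∈ K) (h21 : patPerm ![2, 1] ∈ K) :
    patPerm ![2, 1, 3] ∈ K ∨ patPerm ![3, 1, 2] ∈ K := by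
  obtain ⟨D, hD, h, hh⟩ := hK.exists_amalgam_patPerm (p := ![2, 1, 3]) (by decide)
    (a := 0) (b := 2) (by decide) (by decide) (by decide) h12 h21
  have a1 := (hh 0 1 (by decide) (by decide)).2 (by decide)
  have a2 := (hh 1 2 (by decide) (by decide)).2 (by decide)
  have b1 := (hh 1 0 (by decide) (by decide)).1 (by decide)
  have b2 := (hh 1 2 (by decide) (by decide)).1 (by decide)
  have hperm := (hK.subset_allPerms hD).2
  rcases permLt_trichotomy hperm 0 (h 0) (h 2) with h' | h' | h'
  · refine Or.inl (hK.patPerm_mem_of_three hD (h 0) (h 1) (h 2) (by decide) a1 a2 ?_)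
    intro i j hij
    fin_cases i <;> fin_cases j <;> first | exact absurd hij (by decide) | assumption
  · have := permLt_trans hperm a1 a2
    rw [h'] at this
    exact absurd this (permLt_irrefl hperm 1 _)
  · refine Or.inr (hK.patPerm_mem_of_three hD (h 0) (h 1) (h 2) (by decide) a1 a2 ?_)
    intro i j hij
    fin_cases i <;> fin_cases j <;> first | exact absurd hij (by decide) | assumption

theorem IsAmalgamationClass.p132_or_p231 (hK : IsAmalgamationClass K)
    (h12 : patPerm ![1, 2] ∈ K) (h21 : patPerm ![2, 1] ∈ K) :
    patPerm ![1, 3, 2] ∈ K ∨ patPerm ![2, 3, 1] ∈ K := by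
  obtain ⟨D, hD, h, hh⟩ := hK.exists_amalgam_patPerm (p := ![1, 3, 2]) (by decide)
    (a := 0) (b := 2) (by decide) (by decide) (by decide) h21 h12
  have a1 := (hh 0 1 (by decide) (by decide)).2 (by decide)
  have a2 := (hh 1 2 (by decide) (by decide)).2 (by decide)
  have b1 := (hh 0 1 (by decide) (by decide)).1 (by decide)
  have b2 := (hh 2 1 (by decide) (by decide)).1 (by decide)
  have hperm := (hK.subset_allPerms hD).2
  rcases permLt_trichotomy hperm 0 (h 0) (h 2) with h' | h' | h'
  · refine Or.inl (hK.patPerm_mem_of_three hD (h 0) (h 1) (h 2) (by decide) a1 a2 ?_)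
    intro i j hij
    fin_cases i <;> fin_cases j <;> first | exact absurd hij (by decide) | assumption
  · have := permLt_trans hperm a1 a2
    rw [h'] at this
    exact absurd this (permLt_irrefl hperm 1 _)
  · refine Or.inr (hK.patPerm_mem_of_three hD (h 0) (h 1) (h 2) (by decide) a1 a2 ?_)
    intro i j hij
    fin_cases i <;> fin_cases j <;> first | exact absurd hij (by decide) | assumption

/-- The common point is leftmost and middle in value, so now it is the `<₁`-order of the other two
that is open. -/
theorem IsAmalgamationClass.p213_or_p231 (hK : IsAmalgamationClass K)
    (h12 : patPerm ![1, 2] ∈ K) (h21 : patPerm ![2, 1] ∈ K) :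
    patPerm ![2, 1, 3] ∈ K ∨ patPerm ![2, 3, 1] ∈ K := by
  obtain ⟨D, hD, h, hh⟩ := hK.exists_amalgam_patPerm (p := ![2, 1, 3]) (by decide)
    (a := 1) (b := 2) (by decide) (by decide) (by decide) h12 h21
  have a1 := (hh 0 1 (by decide) (by decide)).2 (by decide)
  have a2 := (hh 0 2 (by decide) (by decide)).2 (by decide)
  have b1 := (hh 1 0 (by decide) (by decide)).1 (by decide)
  have b2 := (hh 0 2 (by decide) (by decide)).1 (by decide)
  have hperm := (hK.subset_allPerms hD).2
  have b3 := permLt_trans hperm b1 b2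
  rcases permLt_trichotomy hperm 1 (h 1) (h 2) with h' | h' | h'
  · refine Or.inl (hK.patPerm_mem_of_three hD (h 0) (h 1) (h 2) (by decide) a1 h' ?_)
    intro i j hij
    fin_cases i <;> fin_cases j <;> first | exact absurd hij (by decide) | assumption
  · rw [h'] at b3
    exact absurd b3 (permLt_irrefl hperm 0 _)
  · refine Or.inr (hK.patPerm_mem_of_three hD (h 0) (h 2) (h 1) (by decide) a2 h' ?_)
    intro i j hij
    fin_cases i <;> fin_cases j <;> first | exact absurd hij (by decide) | assumption

theorem IsAmalgamationClass.p132_or_p312 (hK : IsAmalgamationClass K)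
    (h12 : patPerm ![1, 2] ∈ K) (h21 : patPerm ![2, 1] ∈ K) :
    patPerm ![1, 3, 2] ∈ K ∨ patPerm ![3, 1, 2] ∈ K := by
  obtain ⟨D, hD, h, hh⟩ := hK.exists_amalgam_patPerm (p := ![1, 3, 2]) (by decide)
    (a := 0) (b := 1) (by decide) (by decide) (by decide) h21 h12
  have a1 := (hh 0 2 (by decide) (by decide)).2 (by decide)
  have a2 := (hh 1 2 (by decide) (by decide)).2 (by decide)
  have b1 := (hh 0 2 (by decide) (by decide)).1 (by decide)
  have b2 := (hh 2 1 (by decide) (by decide)).1 (by decide)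
  have hperm := (hK.subset_allPerms hD).2
  have b3 := permLt_trans hperm b1 b2
  rcases permLt_trichotomy hperm 1 (h 0) (h 1) with h' | h' | h'
  · refine Or.inl (hK.patPerm_mem_of_three hD (h 0) (h 1) (h 2) (by decide) h' a2 ?_)
    intro i j hij
    fin_cases i <;> fin_cases j <;> first | exact absurd hij (by decide) | assumption
  · rw [h'] at b3
    exact absurd b3 (permLt_irrefl hperm 0 _)
  · refine Or.inr (hK.patPerm_mem_of_three hD (h 1) (h 0) (h 2) (by decide) h' a1 ?_)
    intro i j hij
    fin_cases i <;> fin_cases j <;> first | exact absurd hij (by decide) | assumption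

/-! ### Forced five-point patterns -/

/-- Every amalgam in the chain is forced. The result contains both 231, the absent three-point
pattern, and 2413. The three lemmas after it are its images under reversing either order or both. -/
theorem IsAmalgamationClass.p31524_mem (hK : IsAmalgamationClass K)
    (h312 : patPerm ![3, 1, 2] ∈ K) (h213 : patPerm ![2, 1, 3] ∈ K)
    (h132 : patPerm ![1, 3, 2] ∈ K) : patPerm ![3, 1, 5, 2, 4] ∈ K := by
  have h3124 : patPerm ![3, 1, 2, 4] ∈ K := hK.patPerm_mem_of_separated (by decide) 1 3 2 2
    (by decide) (by decide) (by decide) (by decide) h213 h312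
  have h1423 : patPerm ![1, 4, 2, 3] ∈ K := hK.patPerm_mem_of_separated (by decide) 0 3 1 2
    (by decide) (by decide) (by decide) (by decide) h312 h132
  exact hK.patPerm_mem_of_separated (by decide) 0 2 1 4
    (by decide) (by decide) (by decide) (by decide) h1423 h3124

theorem IsAmalgamationClass.p42513_mem (hK : IsAmalgamationClass K)
    (h213 : patPerm ![2, 1, 3] ∈ K) (h312 : patPerm ![3, 1, 2] ∈ K)
    (h231 : patPerm ![2, 3, 1] ∈ K) : patPerm ![4, 2, 5, 1, 3] ∈ K := by
  have h4213 : patPerm ![4, 2, 1, 3] ∈ K := hK.patPerm_mem_of_separated (by decide) 0 2 1 1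
    (by decide) (by decide) (by decide) (by decide) h213 h312
  have h3241 : patPerm ![3, 2, 4, 1] ∈ K := hK.patPerm_mem_of_separated (by decide) 0 3 1 1
    (by decide) (by decide) (by decide) (by decide) h231 h213
  exact hK.patPerm_mem_of_separated (by decide) 2 4 3 0
    (by decide) (by decide) (by decide) (by decide) h4213 h3241

theorem IsAmalgamationClass.p24153_mem (hK : IsAmalgamationClass K)
    (h231 : patPerm ![2, 3, 1] ∈ K) (h213 : patPerm ![2, 1, 3] ∈ K)
    (h132 : patPerm ![1, 3, 2] ∈ K) : patPerm ![2, 4, 1, 5, 3] ∈ K := by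
  have h2314 : patPerm ![2, 3, 1, 4] ∈ K := hK.patPerm_mem_of_separated (by decide) 0 3 1 1
    (by decide) (by decide) (by decide) (by decide) h213 h231
  have h1342 : patPerm ![1, 3, 4, 2] ∈ K := hK.patPerm_mem_of_separated (by decide) 0 2 1 1
    (by decide) (by decide) (by decide) (by decide) h231 h132
  exact hK.patPerm_mem_of_separated (by decide) 2 4 3 0
    (by decide) (by decide) (by decide) (by decide) h1342 h2314

theorem IsAmalgamationClass.p35142_mem (hK : IsAmalgamationClass K)
    (h132 : patPerm ![1, 3, 2] ∈ K) (h312 : patPerm ![3, 1, 2] ∈ K)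
    (h231 : patPerm ![2, 3, 1] ∈ K) : patPerm ![3, 5, 1, 4, 2] ∈ K := by
  have h4132 : patPerm ![4, 1, 3, 2] ∈ K := hK.patPerm_mem_of_separated (by decide) 0 3 1 2
    (by decide) (by decide) (by decide) (by decide) h132 h312
  have h2431 : patPerm ![2, 4, 3, 1] ∈ K := hK.patPerm_mem_of_separated (by decide) 1 3 2 0
    (by decide) (by decide) (by decide) (by decide) h231 h132
  exact hK.patPerm_mem_of_separated (by decide) 0 2 1 4
    (by decide) (by decide) (by decide) (by decide) h4132 h2431

/-! ### The classification -/

theorem HasPattern.comp {M : Type u} [permLang.Structure M] {m n : ℕ} {q : Fin m → ℕ}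
    (h : HasPattern M q) {p : Fin n → ℕ} (e : Fin n → Fin m)
    (he : ∀ i j, (q (e i) < q (e j) ↔ p i < p j) ∧ (e i < e j ↔ i < j)) : HasPattern M p := by
  obtain ⟨x, hx⟩ := h
  exact ⟨x ∘ e, fun i j => ⟨(hx _ _).1.trans (he i j).1, (hx _ _).2.trans (he i j).2⟩⟩

theorem hasPattern_12 {M : Type u} [permLang.Structure M] (hM : IsPermutation M) {x y : M}
    (h0 : permLt 0 x y) (h1 : permLt 1 x y) : HasPattern M ![1, 2] := by
  refine ⟨![x, y], ?_⟩
  simp [Fin.forall_fin_two, h0, h1, permLt_irrefl hM, permLt_asymm hM h0, permLt_asymm hM h1]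

theorem hasPattern_21 {M : Type u} [permLang.Structure M] (hM : IsPermutation M) {x y : M}
    (h0 : permLt 0 y x) (h1 : permLt 1 x y) : HasPattern M ![2, 1] := by
  refine ⟨![x, y], ?_⟩
  simp [Fin.forall_fin_two, h0, h1, permLt_irrefl hM, permLt_asymm hM h0, permLt_asymm hM h1]

theorem IsAmalgamationClass.eq_trivialPerms (hK : IsAmalgamationClass K)
    (h12 : patPerm ![1, 2] ∉ K) (h21 : patPerm ![2, 1] ∉ K) : K = trivialPerms := by
  ext P
  constructor
  · intro hP
    have hP' := hK.subset_allPerms hP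
    refine ⟨hP', ⟨fun x y => ?_⟩⟩
    rcases permLt_trichotomy hP'.2 0 x y with h | h | h
    · rcases permLt_trichotomy hP'.2 1 x y with h' | h' | h'
      · exact absurd (hK.patPerm_mem (by decide) hP (hasPattern_12 hP'.2 h h')) h12
      · exact h'
      · exact absurd (hK.patPerm_mem (by decide) hP (hasPattern_21 hP'.2 h h')) h21
    · exact h
    · rcases permLt_trichotomy hP'.2 1 x y with h' | h' | h'
      · exact absurd (hK.patPerm_mem (by decide) hP (hasPattern_21 hP'.2 h h')) h21
      · exact h'
      · exact absurd (hK.patPerm_mem (by decide) hP (hasPattern_12 hP'.2 h h')) h12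
  · rintro ⟨hP, _⟩
    exact hK.mem_of_subsingleton hP

theorem IsAmalgamationClass.eq_identityPerms (hK : IsAmalgamationClass K)
    (h12 : patPerm ![1, 2] ∈ K) (h21 : patPerm ![2, 1] ∉ K) : K = identityPerms := by
  ext P
  constructor
  · intro hP
    have hP' := hK.subset_allPerms hP
    refine ⟨hP', fun x y => ⟨fun h => ?_, fun h => ?_⟩⟩
    · rcases permLt_trichotomy hP'.2 0 x y with h' | rfl | h'
      · exact h'
      · exact absurd h (permLt_irrefl hP'.2 1 _)
      · exact absurd (hK.patPerm_mem (by decide) hP (hasPattern_21 hP'.2 h' h)) h21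
    · rcases permLt_trichotomy hP'.2 1 x y with h' | rfl | h'
      · exact h'
      · exact absurd h (permLt_irrefl hP'.2 0 _)
      · exact absurd (hK.patPerm_mem (by decide) hP (hasPattern_21 hP'.2 h h')) h21
  · rintro ⟨hP, hid⟩
    by_contra hPK
    obtain ⟨n, p, hp, ⟨x, hx⟩, hpK⟩ := hK.exists_minimalPattern P hP hPK
    have h : ∀ i j, p i < p j ↔ i < j := fun i j =>
      (hx i j).1.symm.trans ((hid _ _).symm.trans (hx i j).2)
    cases hp
    · exact hpK h12
    all_goals exact absurd h (by decide)

theorem IsAmalgamationClass.eq_reversalPerms (hK : IsAmalgamationClass K)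
    (h12 : patPerm ![1, 2] ∉ K) (h21 : patPerm ![2, 1] ∈ K) : K = reversalPerms := by
  ext P
  constructor
  · intro hP
    have hP' := hK.subset_allPerms hP
    refine ⟨hP', fun x y => ⟨fun h => ?_, fun h => ?_⟩⟩
    · rcases permLt_trichotomy hP'.2 0 x y with h' | rfl | h'
      · exact absurd (hK.patPerm_mem (by decide) hP (hasPattern_12 hP'.2 h' h)) h12
      · exact absurd h (permLt_irrefl hP'.2 1 _)
      · exact h'
    · rcases permLt_trichotomy hP'.2 1 x y with h' | rfl | h'
      · exact h'
      · exact absurd h (permLt_irrefl hP'.2 0 _)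
      · exact absurd (hK.patPerm_mem (by decide) hP (hasPattern_12 hP'.2 h h')) h12
  · rintro ⟨hP, hrev⟩
    by_contra hPK
    obtain ⟨n, p, hp, ⟨x, hx⟩, hpK⟩ := hK.exists_minimalPattern P hP hPK
    have h : ∀ i j, p i < p j ↔ j < i := fun i j =>
      (hx i j).1.symm.trans ((hrev _ _).symm.trans (hx j i).2)
    cases hp
    · exact absurd h (by decide)
    · exact hpK h21
    all_goals exact absurd h (by decide)

/-- The disjunctions supply 132 and 213, while 2413 and 3142 each contain 231, so no minimal pattern
can be missing from `K` yet present in a permutation of this class. -/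
theorem IsAmalgamationClass.eq_incDecPerms (hK : IsAmalgamationClass K)
    (h12 : patPerm ![1, 2] ∈ K) (h21 : patPerm ![2, 1] ∈ K) (h231 : patPerm ![2, 3, 1] ∉ K)
    (h312 : patPerm ![3, 1, 2] ∉ K) : K = incDecPerms := by
  ext P
  constructor
  · exact fun hP => ⟨hK.subset_allPerms hP, fun h => h231 (hK.patPerm_mem (by decide) hP h),
      fun h => h312 (hK.patPerm_mem (by decide) hP h)⟩
  · rintro ⟨hP, hP231, hP312⟩
    by_contra hPK
    obtain ⟨n, p, hp, hpat, hpK⟩ := hK.exists_minimalPattern P hP hPK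
    cases hp
    · exact hpK h12
    · exact hpK h21
    · exact hpK ((hK.p132_or_p231 h12 h21).resolve_right h231)
    · exact hpK ((hK.p213_or_p231 h12 h21).resolve_right h231)
    · exact hP231 hpat
    · exact hP312 hpat
    · exact hP231 (hpat.comp ![0, 1, 2] (by decide))
    · exact hP231 (hpat.comp ![0, 2, 3] (by decide))

theorem IsAmalgamationClass.eq_decIncPerms (hK : IsAmalgamationClass K)
    (h12 : patPerm ![1, 2] ∈ K) (h21 : patPerm ![2, 1] ∈ K) (h213 : patPerm ![2, 1, 3] ∉ K)
    (h132 : patPerm ![1, 3, 2] ∉ K) : K = decIncPerms := by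
  ext P
  constructor
  · exact fun hP => ⟨hK.subset_allPerms hP, fun h => h213 (hK.patPerm_mem (by decide) hP h),
      fun h => h132 (hK.patPerm_mem (by decide) hP h)⟩
  · rintro ⟨hP, hP213, hP132⟩
    by_contra hPK
    obtain ⟨n, p, hp, hpat, hpK⟩ := hK.exists_minimalPattern P hP hPK
    cases hp
    · exact hpK h12
    · exact hpK h21
    · exact hP132 hpat
    · exact hP213 hpat
    · exact hpK ((hK.p213_or_p231 h12 h21).resolve_left h213)
    · exact hpK ((hK.p213_or_p312 h12 h21).resolve_left h213)
    · exact hP213 (hpat.comp ![0, 2, 3] (by decide))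
    · exact hP213 (hpat.comp ![0, 1, 2] (by decide))

theorem IsAmalgamationClass.eq_allPerms (hK : IsAmalgamationClass K)
    (h12 : patPerm ![1, 2] ∈ K) (h21 : patPerm ![2, 1] ∈ K) (h132 : patPerm ![1, 3, 2] ∈ K)
    (h213 : patPerm ![2, 1, 3] ∈ K) (h231 : patPerm ![2, 3, 1] ∈ K)
    (h312 : patPerm ![3, 1, 2] ∈ K) : K = allPerms := by
  refine hK.subset_allPerms.antisymm fun P hP => ?_
  by_contra hPK
  obtain ⟨n, p, hp, -, hpK⟩ := hK.exists_minimalPattern P hP hPK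
  cases hp
  iterate 6 contradiction
  -- 2413 sits inside 31524, and in the next case 3142 sits inside 42513.
  · exact hpK (hK.patPerm_mem_of_patPerm_mem (hK.p31524_mem h312 h213 h132) (by decide)
      ![0, 2, 3, 4] (by decide))
  · exact hpK (hK.patPerm_mem_of_patPerm_mem (hK.p42513_mem h213 h312 h231) (by decide)
      ![0, 1, 2, 4] (by decide))

/-- The classification of amalgamation classes of permutations. -/
theorem IsAmalgamationClass.classification (hK : IsAmalgamationClass K) :
    K = trivialPerms ∨ K = identityPerms ∨ K = reversalPerms ∨ K = incDecPerms ∨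
      K = decIncPerms ∨ K = allPerms := by
  by_cases h12 : patPerm ![1, 2] ∈ K <;> by_cases h21 : patPerm ![2, 1] ∈ K
  · have hN := hK.p213_or_p312 h12 h21
    have hS := hK.p132_or_p231 h12 h21
    have hE := hK.p213_or_p231 h12 h21
    have hW := hK.p132_or_p312 h12 h21
    have g231 : patPerm ![3, 1, 2] ∈ K → patPerm ![2, 1, 3] ∈ K → patPerm ![1, 3, 2] ∈ K →
        patPerm ![2, 3, 1] ∈ K := fun h1 h2 h3 =>
      hK.patPerm_mem_of_patPerm_mem (hK.p31524_mem h1 h2 h3) (by decide) ![0, 2, 3] (by decide)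
    have g132 : patPerm ![2, 1, 3] ∈ K → patPerm ![3, 1, 2] ∈ K → patPerm ![2, 3, 1] ∈ K →
        patPerm ![1, 3, 2] ∈ K := fun h1 h2 h3 =>
      hK.patPerm_mem_of_patPerm_mem (hK.p42513_mem h1 h2 h3) (by decide) ![1, 2, 4] (by decide)
    have g312 : patPerm ![2, 3, 1] ∈ K → patPerm ![2, 1, 3] ∈ K → patPerm ![1, 3, 2] ∈ K →
        patPerm ![3, 1, 2] ∈ K := fun h1 h2 h3 =>
      hK.patPerm_mem_of_patPerm_mem (hK.p24153_mem h1 h2 h3) (by decide) ![1, 2, 4] (by decide)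
    have g213 : patPerm ![1, 3, 2] ∈ K → patPerm ![3, 1, 2] ∈ K → patPerm ![2, 3, 1] ∈ K →
        patPerm ![2, 1, 3] ∈ K := fun h1 h2 h3 =>
      hK.patPerm_mem_of_patPerm_mem (hK.p35142_mem h1 h2 h3) (by decide) ![0, 2, 3] (by decide)
    have hA : patPerm ![1, 3, 2] ∈ K → patPerm ![2, 1, 3] ∈ K → patPerm ![2, 3, 1] ∈ K →
        patPerm ![3, 1, 2] ∈ K → K = trivialPerms ∨ K = identityPerms ∨ K = reversalPerms ∨
          K = incDecPerms ∨ K = decIncPerms ∨ K = allPerms := fun h1 h2 h3 h4 =>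
      Or.inr (Or.inr (Or.inr (Or.inr (Or.inr (hK.eq_allPerms h12 h21 h1 h2 h3 h4)))))
    by_cases h231 : patPerm ![2, 3, 1] ∈ K <;> by_cases h312 : patPerm ![3, 1, 2] ∈ K
    · by_cases h132 : patPerm ![1, 3, 2] ∈ K
      · exact hA h132 (g213 h132 h312 h231) h231 h312
      · by_cases h213 : patPerm ![2, 1, 3] ∈ K
        · exact hA (g132 h213 h312 h231) h213 h231 h312
        · exact Or.inr (Or.inr (Or.inr (Or.inr (Or.inl (hK.eq_decIncPerms h12 h21 h213 h132)))))
    · have h132 := hW.resolve_right h312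
      have h213 := hN.resolve_right h312
      exact hA h132 h213 h231 (g312 h231 h213 h132)
    · have h132 := hS.resolve_right h231
      have h213 := hE.resolve_right h231
      exact hA h132 h213 (g231 h312 h213 h132) h312
    · exact Or.inr (Or.inr (Or.inr (Or.inl (hK.eq_incDecPerms h12 h21 h231 h312))))
  · exact Or.inr (Or.inl (hK.eq_identityPerms h12 h21))
  · exact Or.inr (Or.inr (Or.inl (hK.eq_reversalPerms h12 h21)))
  · exact Or.inl (hK.eq_trivialPerms h12 h21)

end

/-! ### The six classes -/

theorem trivialPerms_subset_allPerms : trivialPerms.{w} ⊆ allPerms := fun _ h => h.1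

theorem identityPerms_subset_allPerms : identityPerms.{w} ⊆ allPerms := fun _ h => h.1

theorem reversalPerms_subset_allPerms : reversalPerms.{w} ⊆ allPerms := fun _ h => h.1

theorem incDecPerms_subset_allPerms : incDecPerms.{w} ⊆ allPerms := fun _ h => h.1

theorem decIncPerms_subset_allPerms : decIncPerms.{w} ⊆ allPerms := fun _ h => h.1

/-- The ages of nonempty permutations are classes of permutations. -/
theorem isPermutationClass_age (M : Type w) [permLang.Structure M] [Nonempty M]
    (hM : IsPermutation M) : IsPermutationClass (permLang.age M) where
  subset_allPerms := fun A ⟨hfg, ⟨f⟩⟩ => ⟨Language.Structure.fg_iff_finite.1 hfg,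
    (isPermEmb_of_emb f).isPermutation f.injective hM⟩
  exists_nonempty := by
    obtain ⟨m⟩ := ‹Nonempty M›
    exact ⟨⟨Language.Substructure.closure permLang {m}, inferInstance⟩,
      Language.age.fg_substructure (Language.Substructure.fg_closure_singleton m),
      ⟨⟨m, Language.Substructure.subset_closure (Set.mem_singleton m)⟩⟩⟩
  isoClosed := fun A B h hA => (Language.age.is_equiv_invariant permLang M A B h).1 hA
  hereditary := Language.age.hereditary M
  jointEmbedding := Language.age.jointEmbedding M

/-- A class with the Ramsey property and a homogeneous limit. -/
structure IsHomogeneousRamseyClass (K : Set (Bundled.{w} permLang.Structure)) : Prop where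
  subset_allPerms : K ⊆ allPerms
  ramsey : HasRamseyProperty K
  limit : ∃ M, IsPermLimit K M

namespace IsHomogeneousRamseyClass

variable {K : Set (Bundled.{w} permLang.Structure)}

theorem isRamseyClass (h : IsHomogeneousRamseyClass K) : IsRamseyClass K :=
  h.ramsey.isRamseyClass h.subset_allPerms

theorem isPermutationClass (h : IsHomogeneousRamseyClass K) : IsPermutationClass K := by
  obtain ⟨M, hM⟩ := h.limit
  have := hM.nonempty
  rw [← hM.age_eq h.subset_allPerms]
  exact isPermutationClass_age M hM.isPermutation

theorem exists_homogeneous (h : IsHomogeneousRamseyClass K) :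
    ∃ M : Bundled.{w} permLang.Structure, Countable M ∧ IsPermutation M ∧
      permLang.IsUltrahomogeneous M ∧ permLang.age M = K := by
  obtain ⟨M, hM⟩ := h.limit
  exact ⟨M, hM.countable, hM.isPermutation, hM.isUltrahomogeneous h.subset_allPerms,
    hM.age_eq h.subset_allPerms⟩

theorem countable_quotient (h : IsHomogeneousRamseyClass K) :
    ((Quotient.mk (FirstOrder.Language.equivSetoid (L := permLang))) '' K).Countable := by
  obtain ⟨M, hM⟩ := h.limit
  have := hM.countable
  rw [← hM.age_eq h.subset_allPerms]
  exact Language.age.countable_quotient M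

end IsHomogeneousRamseyClass

theorem isHomogeneousRamseyClass_trivialPerms : IsHomogeneousRamseyClass trivialPerms.{w} :=
  ⟨trivialPerms_subset_allPerms, hasRamseyProperty_trivialPerms, _, isPermLimit_trivialPerms⟩

theorem isHomogeneousRamseyClass_identityPerms : IsHomogeneousRamseyClass identityPerms.{w} :=
  ⟨identityPerms_subset_allPerms, hasRamseyProperty_identityPerms, _, isPermLimit_identityPerms⟩

theorem isHomogeneousRamseyClass_reversalPerms : IsHomogeneousRamseyClass reversalPerms.{w} :=
  ⟨reversalPerms_subset_allPerms, reversalPerms_eq ▸ hasRamseyProperty_identityPerms.flip, _,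
    reversalPerms_eq ▸ isPermLimit_identityPerms.flip⟩

theorem isHomogeneousRamseyClass_incDecPerms : IsHomogeneousRamseyClass incDecPerms.{w} :=
  ⟨incDecPerms_subset_allPerms, hasRamseyProperty_incDecPerms, _, isPermLimit_incDecPerms⟩

theorem isHomogeneousRamseyClass_decIncPerms : IsHomogeneousRamseyClass decIncPerms.{w} :=
  ⟨decIncPerms_subset_allPerms, decIncPerms_eq ▸ hasRamseyProperty_incDecPerms.flip, _,
    decIncPerms_eq ▸ isPermLimit_incDecPerms.flip⟩

theorem isHomogeneousRamseyClass_allPerms : IsHomogeneousRamseyClass allPerms.{w} :=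
  ⟨fun _ h => h, hasRamseyProperty_allPerms, _, isPermLimit_allPerms⟩

theorem IsAmalgamationClass.isHomogeneousRamseyClass {K : Set (Bundled.{w} permLang.Structure)}
    (hK : IsAmalgamationClass K) : IsHomogeneousRamseyClass K := by
  rcases hK.classification with rfl | rfl | rfl | rfl | rfl | rfl
  · exact isHomogeneousRamseyClass_trivialPerms
  · exact isHomogeneousRamseyClass_identityPerms
  · exact isHomogeneousRamseyClass_reversalPerms
  · exact isHomogeneousRamseyClass_incDecPerms
  · exact isHomogeneousRamseyClass_decIncPerms
  · exact isHomogeneousRamseyClass_allPerms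

theorem isRamseyClass_age (M : Type w) [permLang.Structure M] [Countable M]
    (hM : IsPermutation M) (hh : permLang.IsUltrahomogeneous M) :
    IsRamseyClass (permLang.age M) := by
  -- The empty permutation is homogeneous, but its age has no nonempty member and is outside the
  -- classification; all its members are empty, so there is only one embedding to colour.
  rcases isEmpty_or_nonempty M with hemp | hne
  · intro A hA B hB r
    have hAe : IsEmpty A := ⟨fun a => hemp.false (hA.2.some a)⟩
    have hBe : IsEmpty B := ⟨fun b => hemp.false (hB.2.some b)⟩
    refine ⟨A, hA, fun χ => ⟨χ (Language.Embedding.refl permLang A), ⊤,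
      ⟨Language.Equiv.comp ?_ Language.Substructure.topEquiv⟩, fun f => ?_⟩⟩
    · exact
      { toFun := fun a => (hAe.false a).elim
        invFun := fun b => (hBe.false b).elim
        left_inv := fun a => (hAe.false a).elim
        right_inv := fun b => (hBe.false b).elim
        map_fun' := fun g => Empty.elim g
        map_rel' := fun {n} R x => by
          cases R
          exact (hAe.false (x 0)).elim }
    · congr 1
      ext a
      exact (hAe.false a).elim
  · exact ((isPermutationClass_age M hM).isAmalgamationClass
      hh.amalgamation_age).isHomogeneousRamseyClass.isRamseyClass

/-! ### Counting -/

/-- Cardinality is an isomorphism invariant, and its values exhaust `ℕ`. -/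
theorem infinite_quotient_of_card {K : Set (Bundled.{w} permLang.Structure)}
    (h : ∀ n : ℕ, ∃ A ∈ K, Nat.card A = n) :
    ((Quotient.mk (FirstOrder.Language.equivSetoid (L := permLang))) '' K).Infinite := by
  let c : Quotient (FirstOrder.Language.equivSetoid.{_, _, w} (L := permLang)) → ℕ :=
    Quotient.lift (fun A => Nat.card A) (fun A B ⟨e⟩ => Nat.card_congr e.toEquiv)
  refine Set.Infinite.of_image c ?_
  have : c '' (Quotient.mk _ '' K) = Set.univ := by
    refine Set.eq_univ_of_forall fun n => ?_
    obtain ⟨A, hA, rfl⟩ := h n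
    exact ⟨_, ⟨A, hA, rfl⟩, rfl⟩
  rw [this]
  exact Set.infinite_univ

theorem not_isCountablyInfiniteClass_trivialPerms :
    ¬ IsCountablyInfiniteClass trivialPerms.{w} := by
  rintro ⟨hinf, -⟩
  refine hinf (Set.Finite.subset (Set.toFinite
    ((Quotient.mk (FirstOrder.Language.equivSetoid (L := permLang))) ''
      {permOf (M := PEmpty) (fun _ => 0) (fun _ => 0),
        permOf (M := PUnit) (fun _ => 0) (fun _ => 0)})) ?_)
  rintro _ ⟨A, ⟨hA, hsub⟩, rfl⟩
  rcases isEmpty_or_nonempty A with hemp | ⟨⟨a⟩⟩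
  · refine ⟨_, Or.inl rfl, Quotient.sound ⟨?_⟩⟩
    exact
      { toFun := fun x => PEmpty.elim x
        invFun := fun x => (hemp.false x).elim
        left_inv := fun x => PEmpty.elim x
        right_inv := fun x => (hemp.false x).elim
        map_fun' := fun g => Empty.elim g
        map_rel' := fun {n} R x => by
          cases R
          exact PEmpty.elim (x 0) }
  · refine ⟨_, Or.inr rfl, Quotient.sound ⟨?_⟩⟩
    exact
      { toFun := fun _ => a
        invFun := fun _ => PUnit.unit
        left_inv := fun _ => rfl
        right_inv := fun _ => Subsingleton.elim _ _
        map_fun' := fun g => Empty.elim g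
        map_rel' := fun {n} R x => by
          cases R with
          | lt i =>
            rw [relMap_permLt, relMap_permLt]
            refine iff_of_false (permLt_irrefl hA.2 i a) ?_
            exact permLt_irrefl (isPermutation_permOf (Function.injective_of_subsingleton _)
              (Function.injective_of_subsingleton _)) i _ }

theorem identityPerms_card (n : ℕ) : ∃ A ∈ identityPerms.{w}, Nat.card A = n :=
  ⟨permOf (M := ULift (Fin n)) ULift.down ULift.down,
    ⟨⟨inferInstanceAs (Finite (ULift (Fin n))),
      isPermutation_permOf ULift.down_injective ULift.down_injective⟩, fun _ _ => Iff.rfl⟩, by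
    change Nat.card (ULift (Fin n)) = n
    simp⟩

theorem reversalPerms_card (n : ℕ) : ∃ A ∈ reversalPerms.{w}, Nat.card A = n := by
  obtain ⟨A, hA, hn⟩ := identityPerms_card.{w} n
  refine ⟨flipPerm A, ?_, hn⟩
  rw [reversalPerms_eq, Set.mem_ofPred_eq, flipPerm_flipPerm]
  exact hA

/-- The patterns of an identity permutation are increasing. -/
theorem lt_iff_of_hasPattern_identity {A : Bundled.{w} permLang.Structure} (hA : A ∈ identityPerms)
    {n : ℕ} {p : Fin n → ℕ} (h : HasPattern A p) (i j : Fin n) : p i < p j ↔ i < j := by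
  obtain ⟨x, hx⟩ := h
  exact (hx i j).1.symm.trans ((hA.2 _ _).symm.trans (hx i j).2)

theorem identityPerms_subset_incDecPerms : identityPerms.{w} ⊆ incDecPerms := fun A hA =>
  ⟨hA.1, fun h => absurd (lt_iff_of_hasPattern_identity hA h) (by decide),
    fun h => absurd (lt_iff_of_hasPattern_identity hA h) (by decide)⟩

theorem identityPerms_subset_decIncPerms : identityPerms.{w} ⊆ decIncPerms := fun A hA =>
  ⟨hA.1, fun h => absurd (lt_iff_of_hasPattern_identity hA h) (by decide),
    fun h => absurd (lt_iff_of_hasPattern_identity hA h) (by decide)⟩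

theorem hasPattern_patPerm_iff {m n : ℕ} {q : Fin m → ℕ} {p : Fin n → ℕ} :
    HasPattern (patPerm.{w} q) p ↔
      ∃ x : Fin n → Fin m, ∀ i j, (q (x i) < q (x j) ↔ p i < p j) ∧ (x i < x j ↔ i < j) :=
  ⟨fun ⟨x, hx⟩ => ⟨fun i => (x i).down, hx⟩, fun ⟨x, hx⟩ => ⟨fun i => ULift.up (x i), hx⟩⟩

theorem patPerm_mem_identityPerms_iff {n : ℕ} {p : Fin n → ℕ} (hp : Function.Injective p) :
    patPerm.{w} p ∈ identityPerms ↔ ∀ i j, i < j ↔ p i < p j :=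
  ⟨fun h i j => h.2 (ULift.up i) (ULift.up j), fun h =>
    ⟨patPerm_mem_allPerms hp, fun x y => h x.down y.down⟩⟩

theorem patPerm_mem_reversalPerms_iff {n : ℕ} {p : Fin n → ℕ} (hp : Function.Injective p) :
    patPerm.{w} p ∈ reversalPerms ↔ ∀ i j, i < j ↔ p j < p i :=
  ⟨fun h i j => h.2 (ULift.up i) (ULift.up j), fun h =>
    ⟨patPerm_mem_allPerms hp, fun x y => h x.down y.down⟩⟩

theorem p213_mem_incDecPerms : patPerm.{w} ![2, 1, 3] ∈ incDecPerms :=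
  ⟨patPerm_mem_allPerms (by decide), by rw [hasPattern_patPerm_iff]; decide,
    by rw [hasPattern_patPerm_iff]; decide⟩

theorem p231_mem_decIncPerms : patPerm.{w} ![2, 3, 1] ∈ decIncPerms :=
  ⟨patPerm_mem_allPerms (by decide), by rw [hasPattern_patPerm_iff]; decide,
    by rw [hasPattern_patPerm_iff]; decide⟩

theorem hasPattern_patPerm_self {n : ℕ} (p : Fin n → ℕ) : HasPattern (patPerm.{w} p) p :=
  hasPattern_patPerm_iff.2 ⟨id, fun _ _ => ⟨Iff.rfl, Iff.rfl⟩⟩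

theorem p231_notMem_incDecPerms : patPerm.{w} ![2, 3, 1] ∉ incDecPerms :=
  fun h => h.2.1 (hasPattern_patPerm_self _)

theorem p213_notMem_decIncPerms : patPerm.{w} ![2, 1, 3] ∉ decIncPerms :=
  fun h => h.2.1 (hasPattern_patPerm_self _)

theorem ncard_infinite_classes :
    ({identityPerms, reversalPerms, incDecPerms, decIncPerms, allPerms} :
      Set (Set (Bundled.{w} permLang.Structure))).ncard = 5 := by
  have i213 : patPerm.{w} ![2, 1, 3] ∉ identityPerms := by
    rw [patPerm_mem_identityPerms_iff (by decide)]; decide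
  have i231 : patPerm.{w} ![2, 3, 1] ∉ identityPerms := by
    rw [patPerm_mem_identityPerms_iff (by decide)]; decide
  have r213 : patPerm.{w} ![2, 1, 3] ∉ reversalPerms := by
    rw [patPerm_mem_reversalPerms_iff (by decide)]; decide
  have r231 : patPerm.{w} ![2, 3, 1] ∉ reversalPerms := by
    rw [patPerm_mem_reversalPerms_iff (by decide)]; decide
  have i12 : patPerm.{w} ![1, 2] ∈ identityPerms := by
    rw [patPerm_mem_identityPerms_iff (by decide)]; decide
  have r12 : patPerm.{w} ![1, 2] ∉ reversalPerms := by
    rw [patPerm_mem_reversalPerms_iff (by decide)]; decide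
  have a213 : patPerm.{w} ![2, 1, 3] ∈ allPerms := patPerm_mem_allPerms (by decide)
  have a231 : patPerm.{w} ![2, 3, 1] ∈ allPerms := patPerm_mem_allPerms (by decide)
  have hne : ∀ {K L : Set (Bundled.{w} permLang.Structure)} {A}, A ∉ K → A ∈ L → K ≠ L :=
    fun h h' e => h (e ▸ h')
  rw [Set.ncard_insert_of_notMem, Set.ncard_insert_of_notMem, Set.ncard_insert_of_notMem,
    Set.ncard_pair]
  · exact hne p213_notMem_decIncPerms a213
  · rintro (h | h)
    · exact hne p231_notMem_incDecPerms p231_mem_decIncPerms h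
    · exact hne p231_notMem_incDecPerms a231 h
  · rintro (h | h | h)
    · exact hne r213 p213_mem_incDecPerms h
    · exact hne r231 p231_mem_decIncPerms h
    · exact hne r231 a231 h
  · rintro (h | h | h | h)
    · exact hne r12 i12 h.symm
    · exact hne i213 p213_mem_incDecPerms h
    · exact hne i231 p231_mem_decIncPerms h
    · exact hne i231 a231 h

/-! ### The list of Ramsey classes and the main theorem -/

theorem isPermutationClass_and_isRamseyClass_iff (K : Set (Bundled.{w} permLang.Structure)) :
    IsPermutationClass K ∧ IsRamseyClass K ↔
      K = trivialPerms ∨ K = identityPerms ∨ K = reversalPerms ∨ K = incDecPerms ∨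
        K = decIncPerms ∨ K = allPerms := by
  constructor
  · rintro ⟨hK, hR⟩
    exact (hK.isAmalgamationClass_of_isRamseyClass hR).classification
  · have key : ∀ {L : Set (Bundled.{w} permLang.Structure)}, IsHomogeneousRamseyClass L →
        IsPermutationClass L ∧ IsRamseyClass L := fun h => ⟨h.isPermutationClass, h.isRamseyClass⟩
    rintro (rfl | rfl | rfl | rfl | rfl | rfl)
    · exact key isHomogeneousRamseyClass_trivialPerms
    · exact key isHomogeneousRamseyClass_identityPerms
    · exact key isHomogeneousRamseyClass_reversalPerms
    · exact key isHomogeneousRamseyClass_incDecPerms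
    · exact key isHomogeneousRamseyClass_decIncPerms
    · exact key isHomogeneousRamseyClass_allPerms

theorem setOf_countablyInfinite_ramsey_classes :
    {K : Set (Bundled.{w} permLang.Structure) | IsPermutationClass K ∧ IsRamseyClass K ∧
      IsCountablyInfiniteClass K} =
      {identityPerms, reversalPerms, incDecPerms, decIncPerms, allPerms} := by
  ext K
  constructor
  · rintro ⟨h1, h2, h3⟩
    rcases (isPermutationClass_and_isRamseyClass_iff K).1 ⟨h1, h2⟩ with rfl | h
    · exact absurd h3 not_isCountablyInfiniteClass_trivialPerms
    · exact h
  · have key : ∀ {L : Set (Bundled.{w} permLang.Structure)}, IsHomogeneousRamseyClass L →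
        (∀ n : ℕ, ∃ A ∈ L, Nat.card A = n) →
        IsPermutationClass L ∧ IsRamseyClass L ∧ IsCountablyInfiniteClass L := fun h hc =>
      ⟨h.isPermutationClass, h.isRamseyClass, infinite_quotient_of_card hc, h.countable_quotient⟩
    have hid : ∀ {L : Set (Bundled.{w} permLang.Structure)}, identityPerms ⊆ L →
        ∀ n : ℕ, ∃ A ∈ L, Nat.card A = n := fun hL n =>
      let ⟨A, hA, hn⟩ := identityPerms_card n
      ⟨A, hL hA, hn⟩
    rintro (rfl | rfl | rfl | rfl | rfl)
    · exact key isHomogeneousRamseyClass_identityPerms identityPerms_card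
    · exact key isHomogeneousRamseyClass_reversalPerms reversalPerms_card
    · exact key isHomogeneousRamseyClass_incDecPerms (hid identityPerms_subset_incDecPerms)
    · exact key isHomogeneousRamseyClass_decIncPerms (hid identityPerms_subset_decIncPerms)
    · exact key isHomogeneousRamseyClass_allPerms (hid identityPerms_subset_allPerms)

theorem mainTheorem1 :
    -- the age of each countable homogeneous permutation is a Ramsey class
    (∀ (M : Type w) [permLang.Structure M] [Countable M],
      IsPermutation M → permLang.IsUltrahomogeneous M → IsRamseyClass (permLang.age M)) ∧
    -- the Ramsey classes of permutations are exactly these ages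
    (∀ K : Set (Bundled.{w} permLang.Structure), IsPermutationClass K →
      (IsRamseyClass K ↔ ∃ M : Bundled.{w} permLang.Structure, Countable M ∧ IsPermutation M ∧
        permLang.IsUltrahomogeneous M ∧ permLang.age M = K)) ∧
    -- these are the following six classes
    {K : Set (Bundled.{w} permLang.Structure) | IsPermutationClass K ∧ IsRamseyClass K} =
      {trivialPerms, identityPerms, reversalPerms, incDecPerms, decIncPerms, allPerms} ∧
    -- exactly five of them are countably infinite
    {K : Set (Bundled.{w} permLang.Structure) | IsPermutationClass K ∧ IsRamseyClass K ∧
      IsCountablyInfiniteClass K}.ncard = 5 := by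
  refine ⟨fun M _ _ => isRamseyClass_age M, fun K hK => ⟨fun hR => ?_, ?_⟩, ?_, ?_⟩
  · exact (hK.isAmalgamationClass_of_isRamseyClass hR).isHomogeneousRamseyClass.exists_homogeneous
  · rintro ⟨M, hc, hM, hh, rfl⟩
    exact isRamseyClass_age M hM hh
  · ext K
    exact isPermutationClass_and_isRamseyClass_iff K
  · rw [setOf_countablyInfinite_ramsey_classes, ncard_infinite_classes]
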